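/- Let $\Omega\subset\mathbb R^N$ be open and let $1<p<\infty$, $p-1<s_1<\infty$, $p-1<s_2\le\infty$, $0<\alpha p<N$ and $0<R<\infty$. Let $\mu$ be a positive Radon measure in $\Omega$; measures in $\Omega$ are extended by $0$ to $\mathbb R^N$. Notation. For a measurable function $f$ on $\mathbb R^N$ put $f^*(t)=\inf\{s>0: |\{|f|>s\}|\le t\}$ and $f^{**}(t)=\frac1t\int_0^t f^*(\tau)\,d\tau$. The Lorentz space $L^{s,q}(\mathbb R^N)$ is the set of $f$ with $\|f\|_{s,q}<\infty$, where $\|f\|_{s,q}=\|t^{1/s}f^{**}\|_{L^q((0,\infty),dt/t)}$ if $s>1$ and $q\ge1$, and $\|f\|_{s,q}=\|t^{1/s}f^{*}\|_{L^q((0,\infty),dt/t)}$ for the other exponents $0<s<\infty$, $0<q\le\infty$. Let $G_a$ be the Bessel kernel of order $a>0$ (the convolution kernel of $(1-\Delta)^{-a/2}$) and $C_{a,s,q}(E)=\inf\{\|f\|_{s,q}: f\ge 0,\ G_a*f\ge1 \text{ on } E\}$. Finally let $$\mathbf W^R_{\alpha,p}[\nu](x)=\int_0^R\Big(\frac{\nu(B_t(x))}{t^{N-\alpha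 p}}\Big)^{\frac1{p-1}}\frac{dt}{t}.$$ Suppose that $\mu$ is absolutely continuous in $\Omega$ with respect to the capacity $C_{\alpha p,\frac{s_1}{s_1-p+1},\frac{s_2}{s_2-p+1}}$ (where $\frac{s_2}{s_2-p+1}=1$ if $s_2=\infty$), that is, $\mu(E)=0$ for every Borel set $E\subset\Omega$ whose capacity is $0$. Then there is a nondecreasing sequence $(\mu_n)$ of positive Radon measures with compact support in $\Omega$ such that $\int\phi\,d\mu_n\to\int\phi\,d\mu$ for every $\phi\in C_c(\Omega)$ and $\mathbf W^R_{\alpha,p}[\mu_n]\in L^{s_1,s_2}(\mathbb R^N)$ for every $n$. If moreover $\mu(\Omega)<\infty$, then this sequence also converges to $\mu$ narrowly, i.e. $\int_\Omega\phi\,d\mu_n\to\int_\Omega\phi\,d\mu$ for every bounded continuous function $\phi$ on $\Omega$. -/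

import Mathlib

open MeasureTheory Set Filter Topology
open scoped ENNReal

noncomputable section

namespace LorentzBessel

section Lorentz

variable {X : Type*} [MeasurableSpace X]

/-- The decreasing rearrangement `f*(t) = inf {s > 0 : ν {f > s} ≤ t}` of a `[0,∞]`-valued
function `f`. -/
def rearrangement (ν : Measure X) (f : X → ℝ≥0∞) (t : ℝ) : ℝ≥0∞ :=
  sInf {s : ℝ≥0∞ | 0 < s ∧ ν {x | s < f x} ≤ ENNReal.ofReal t}

/-- The averaged rearrangement `f**(t) = (1/t) ∫₀ᵗ f*(τ) dτ`, for `t > 0`. -/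
def maximalRearrangement (ν : Measure X) (f : X → ℝ≥0∞) (t : ℝ) : ℝ≥0∞ :=
  (∫⁻ τ in Ioo 0 t, rearrangement ν f τ) / ENNReal.ofReal t

/-- The measure `dt/t` on the half-line `(0,∞)`. -/
def haarHalfLine : Measure ℝ :=
  (volume.restrict (Ioi (0 : ℝ))).withDensity fun t => (ENNReal.ofReal t)⁻¹

open Classical in
/-- The Lorentz (quasi-)norm of `L^{s,q}`. If `s > 1` and `q ≥ 1` it is the norm
`‖t^{1/s} f**‖` in `L^q((0,∞), dt/t)`; for the remaining exponents (for which `f**` does not give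
the Lorentz space) it is the usual quasi-norm `‖t^{1/s} f*‖` in `L^q((0,∞), dt/t)`. -/
def lorentzNorm (ν : Measure X) (s : ℝ) (q : ℝ≥0∞) (f : X → ℝ≥0∞) : ℝ≥0∞ :=
  if 1 < s ∧ 1 ≤ q then
    eLpNorm (fun t : ℝ => ENNReal.ofReal (t ^ (1 / s)) * maximalRearrangement ν f t) q haarHalfLine
  else
    eLpNorm (fun t : ℝ => ENNReal.ofReal (t ^ (1 / s)) * rearrangement ν f t) q haarHalfLine

/-- `f` belongs to the Lorentz space `L^{s,q}`. Finiteness of the quasi-norm forces `f < ∞` a.e.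
in the range `0 < s < ∞`, `0 < q ≤ ∞`. -/
def MemLorentz (ν : Measure X) (s : ℝ) (q : ℝ≥0∞) (f : X → ℝ≥0∞) : Prop :=
  AEMeasurable f ν ∧ lorentzNorm ν s q f < ∞

end Lorentz

/-- The Bessel kernel `G_a` of order `a > 0` in `ℝ^N`, that is the convolution kernel of
`(1 - Δ)^{-a/2}`, written through the heat kernel:
`G_a(x) = Γ(a/2)⁻¹ ∫₀^∞ t^{a/2} e^{-t} (4πt)^{-N/2} e^{-|x|²/(4t)} dt/t`. -/
def besselKernel {N : ℕ} (a : ℝ) (x : EuclideanSpace ℝ (Fin N)) : ℝ≥0∞ :=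
  ENNReal.ofReal (Real.Gamma (a / 2))⁻¹ *
    ∫⁻ t in Ioi (0 : ℝ), ENNReal.ofReal
      (t ^ (a / 2 - 1) * Real.exp (-t) * (4 * Real.pi * t) ^ (-(N : ℝ) / 2) *
        Real.exp (-‖x‖ ^ 2 / (4 * t)))

/-- The Bessel potential `G_a * f` of a function `f ≥ 0`. -/
def besselPotential {N : ℕ} (a : ℝ) (f : EuclideanSpace ℝ (Fin N) → ℝ≥0∞)
    (x : EuclideanSpace ℝ (Fin N)) : ℝ≥0∞ :=
  ∫⁻ y, besselKernel a (x - y) * f y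

/-- The Lorentz-Bessel capacity
`C_{a,s,q}(E) = inf {‖f‖_{s,q} : f ≥ 0, G_a * f ≥ 1 on E}`. -/
def lorentzBesselCapacity {N : ℕ} (a s : ℝ) (q : ℝ≥0∞)
    (E : Set (EuclideanSpace ℝ (Fin N))) : ℝ≥0∞ :=
  ⨅ (f : EuclideanSpace ℝ (Fin N) → ℝ≥0∞) (_ : Measurable f)
    (_ : ∀ x ∈ E, 1 ≤ besselPotential a f x), lorentzNorm volume s q f

/-- `μ` is absolutely continuous in `Ω` with respect to the capacity `C_{a,s,q}`. -/
def AbsContCapacity {N : ℕ} (a s : ℝ) (q : ℝ≥0∞) (Ω : Set (EuclideanSpace ℝ (Fin N)))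
    (μ : Measure (EuclideanSpace ℝ (Fin N))) : Prop :=
  ∀ E ⊆ Ω, MeasurableSet E → lorentzBesselCapacity a s q E = 0 → μ E = 0

/-- The `R`-truncated Wolff potential
`W^R_{α,p}[μ](x) = ∫₀^R (μ(B_t(x)) / t^{N-αp})^{1/(p-1)} dt/t`. -/
def wolffPotential {N : ℕ} (α p R : ℝ) (μ : Measure (EuclideanSpace ℝ (Fin N)))
    (x : EuclideanSpace ℝ (Fin N)) : ℝ≥0∞ :=
  ∫⁻ t in Ioo (0 : ℝ) R,
    (μ (Metric.ball x t) / ENNReal.ofReal (t ^ ((N : ℝ) - α * p))) ^ (1 / (p - 1)) /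
      ENNReal.ofReal t

/-- The exponent `s / (s - p + 1)` for `p - 1 < s ≤ ∞`, equal to `1` for `s = ∞`. -/
def capacityExponent (p : ℝ) (s : ℝ≥0∞) : ℝ≥0∞ :=
  if s = ∞ then 1 else ENNReal.ofReal (s.toReal / (s.toReal - p + 1))

/-- `μ` is a positive Radon measure in the open set `Ω`, extended by zero outside `Ω`. -/
def IsRadonIn {N : ℕ} (Ω : Set (EuclideanSpace ℝ (Fin N)))
    (μ : Measure (EuclideanSpace ℝ (Fin N))) : Prop :=
  μ Ωᶜ = 0 ∧ ∀ K ⊆ Ω, IsCompact K → μ K < ∞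

/-- `μ` has compact support in `Ω`. -/
def HasCompactSupportIn {N : ℕ} (Ω : Set (EuclideanSpace ℝ (Fin N)))
    (μ : Measure (EuclideanSpace ℝ (Fin N))) : Prop :=
  ∃ K ⊆ Ω, IsCompact K ∧ μ Kᶜ = 0

/-- Weak convergence of measures in `Ω`: tested against `C_c(Ω)`. -/
def TendstoWeakly {N : ℕ} (Ω : Set (EuclideanSpace ℝ (Fin N)))
    (μs : ℕ → Measure (EuclideanSpace ℝ (Fin N)))
    (μ : Measure (EuclideanSpace ℝ (Fin N))) : Prop :=
  ∀ φ : EuclideanSpace ℝ (Fin N) → ℝ, Continuous φ → HasCompactSupport φ → tsupport φ ⊆ Ω →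
    Tendsto (fun n => ∫ x, φ x ∂(μs n)) atTop (𝓝 (∫ x, φ x ∂μ))

/-- Narrow convergence of bounded measures in `Ω`: tested against the continuous bounded
functions on `Ω`. -/
def TendstoNarrowly {N : ℕ} (Ω : Set (EuclideanSpace ℝ (Fin N)))
    (μs : ℕ → Measure (EuclideanSpace ℝ (Fin N)))
    (μ : Measure (EuclideanSpace ℝ (Fin N))) : Prop :=
  ∀ φ : EuclideanSpace ℝ (Fin N) → ℝ, ContinuousOn φ Ω → (∃ C : ℝ, ∀ x ∈ Ω, |φ x| ≤ C) →
    Tendsto (fun n => ∫ x in Ω, φ x ∂(μs n)) atTop (𝓝 (∫ x in Ω, φ x ∂μ))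

end LorentzBessel

end

/-! Write a = αp, γ = 1/(p-1), and let s, q be the two exponents of the capacity; their conjugates
are s₁/(p-1) and s₂/(p-1). The measures μ_n are restrictions of μ to sets A_n increasing to μ-almost
all of Ω, so both convergences are dominated convergence. What matters is to find enough sets A for
which the Wolff potential of μ|A lies in L^{s₁,s₂}.

Choice of the sets. The unit ball of L^{s,q} is replaced by `interpolationBall`, made of sums of
pieces controlled in L^1 and L^∞. It is countably convex, also for q = 1, and it is bounded in
L^{s,q}. If μ does not charge sets of zero capacity, the potentials G_a * f, f in this ball, are
bounded in measure on every set of finite μ-measure: otherwise a Borel-Cantelli argument produces a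
set of zero capacity and positive measure (`exists_measure_lt_besselPotential_le`). A Hahn-Banach
argument in the style of Nikishin and Maurey (`exists_setLIntegral_le_of_bounded_in_measure`) turns
boundedness in measure into boundedness in L^1(μ) on a subset of positive measure. Such subsets are
stable under finite unions, so they exhaust Ω.

From the sets to the Wolff potential. Let ν = μ|A. Since G_a dominates a truncated dyadic Riesz
kernel, the bound on ∫ G_a * f dν bounds the pairing of f with the dyadic potential P of ν; testing
with superlevel sets of P gives P ∈ L^{s₁/(p-1), s₂/(p-1)}, that is P^γ ∈ L^{s₁,s₂}. The Wolff
potential is at most a multiple of a sum F of γ-th powers of the terms of P, up to a change of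
balls. For γ ≥ 1, F ≤ P^γ pointwise. For γ < 1 this fails, and a good-λ inequality along the dyadic
filtration (`rearrangement_tsum_le_add`) gives F*(t) ≤ C ∑_j (P*(2^j t/2))^γ instead; a Hardy-type
inequality in ℓ^{s₂} finishes, and s₂ > p-1 > 1 in this case. -/

namespace LorentzBessel

/-! ### Decreasing rearrangements -/

section Rearrangement

variable {X : Type*} [MeasurableSpace X] {ν : Measure X} {f g : X → ℝ≥0∞} {t : ℝ}

/-- The infimum defining f* is approached along a decreasing sequence of levels, whose superlevel
sets increase; continuity from below gives the bound at the infimum itself. -/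
theorem measure_rearrangement_lt_le (ν : Measure X) (f : X → ℝ≥0∞) (t : ℝ) :
    ν {x | rearrangement ν f t < f x} ≤ ENNReal.ofReal t := by
  have hne : {s : ℝ≥0∞ | 0 < s ∧ ν {x | s < f x} ≤ ENNReal.ofReal t}.Nonempty :=
    ⟨⊤, by simp⟩
  obtain ⟨u, hu, hlim, hmem⟩ := exists_seq_tendsto_sInf hne (OrderBot.bddBelow _)
  change Tendsto u atTop (𝓝 (rearrangement ν f t)) at hlim
  have heq : {x | rearrangement ν f t < f x} ⊆ ⋃ n, {x | u n < f x} := by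
    intro x hx
    obtain ⟨n, hn⟩ := (hlim.eventually_lt_const hx).exists
    exact mem_iUnion.2 ⟨n, hn⟩
  have hmono : Monotone fun n => {x | u n < f x} := fun m n hmn x hx =>
    lt_of_le_of_lt (hu hmn) hx
  calc ν {x | rearrangement ν f t < f x} ≤ ν (⋃ n, {x | u n < f x}) := measure_mono heq
    _ = ⨆ n, ν {x | u n < f x} := hmono.measure_iUnion
    _ ≤ ENNReal.ofReal t := iSup_le fun n => (hmem n).2

theorem rearrangement_le {s : ℝ≥0∞} (h : ν {x | s < f x} ≤ ENNReal.ofReal t) :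
    rearrangement ν f t ≤ s := by
  refine le_of_forall_gt_imp_ge_of_dense fun s' hs' => sInf_le ⟨bot_le.trans_lt hs', ?_⟩
  exact (measure_mono fun x (hx : s' < f x) => hs'.trans hx).trans h

theorem lt_measure_of_lt_rearrangement {s : ℝ≥0∞} (h : s < rearrangement ν f t) :
    ENNReal.ofReal t < ν {x | s < f x} := by
  by_contra! h'
  exact absurd (rearrangement_le h') (not_le.2 h)

theorem rearrangement_antitone (ν : Measure X) (f : X → ℝ≥0∞) :
    Antitone (rearrangement ν f) := fun _ _ h =>
  rearrangement_le ((measure_rearrangement_lt_le ν f _).trans (ENNReal.ofReal_le_ofReal h))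

theorem measurable_rearrangement (ν : Measure X) (f : X → ℝ≥0∞) :
    Measurable (rearrangement ν f) := (rearrangement_antitone ν f).measurable

theorem rearrangement_add_le {c : ℝ≥0∞} (hg : ∀ x, g x ≤ c + f x) :
    rearrangement ν g t ≤ c + rearrangement ν f t := by
  refine rearrangement_le ((measure_mono fun x hx => ?_).trans (measure_rearrangement_lt_le ν f t))
  by_contra! h
  exact absurd ((hg x).trans (add_le_add le_rfl (not_lt.1 h))) (not_le.2 hx)

theorem rearrangement_le_of_monotone {φ : ℝ≥0∞ → ℝ≥0∞} (hφ : Monotone φ)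
    (hg : ∀ x, g x ≤ φ (f x)) : rearrangement ν g t ≤ φ (rearrangement ν f t) := by
  refine rearrangement_le ((measure_mono fun x hx => ?_).trans (measure_rearrangement_lt_le ν f t))
  by_contra! h
  exact absurd ((hg x).trans (hφ (not_lt.1 h))) (not_le.2 hx)

theorem volume_setOf_ofReal_lt (y : ℝ≥0∞) :
    ∫⁻ s in Ioi (0 : ℝ), {s : ℝ | ENNReal.ofReal s < y}.indicator 1 s = y := by
  have hm : MeasurableSet {s : ℝ | ENNReal.ofReal s < y} :=
    measurableSet_lt ENNReal.measurable_ofReal measurable_const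
  rw [lintegral_indicator_one hm, Measure.restrict_apply hm]
  rcases eq_or_ne y ⊤ with rfl | hy
  · simp [Set.inter_comm]
  · have : {s : ℝ | ENNReal.ofReal s < y} ∩ Ioi 0 = Ioo 0 y.toReal := by
      ext s
      simp only [mem_inter_iff, mem_ofPred_eq, mem_Ioi, mem_Ioo]
      constructor
      · rintro ⟨h1, h2⟩
        exact ⟨h2, (ENNReal.ofReal_lt_iff_lt_toReal h2.le hy).1 h1⟩
      · rintro ⟨h1, h2⟩
        exact ⟨(ENNReal.ofReal_lt_iff_lt_toReal h1.le hy).2 h2, h1⟩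
    rw [this, Real.volume_Ioo, sub_zero, ENNReal.ofReal_toReal hy]

theorem lintegral_eq_lintegral_measure_ofReal_lt [SFinite ν] (hf : Measurable f) :
    ∫⁻ x, f x ∂ν = ∫⁻ s in Ioi (0 : ℝ), ν {x | ENNReal.ofReal s < f x} := by
  have hm : MeasurableSet {q : X × ℝ | ENNReal.ofReal q.2 < f q.1} :=
    measurableSet_lt (ENNReal.measurable_ofReal.comp measurable_snd) (hf.comp measurable_fst)
  calc ∫⁻ x, f x ∂ν
      = ∫⁻ x, (∫⁻ s in Ioi (0 : ℝ),
          {q : X × ℝ | ENNReal.ofReal q.2 < f q.1}.indicator 1 (x, s)) ∂ν :=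
        lintegral_congr fun x => (volume_setOf_ofReal_lt (f x)).symm
    _ = ∫⁻ s in Ioi (0 : ℝ), ∫⁻ x,
          {q : X × ℝ | ENNReal.ofReal q.2 < f q.1}.indicator 1 (x, s) ∂ν :=
        lintegral_lintegral_swap ((measurable_one.indicator hm).aemeasurable)
    _ = _ := by
        refine lintegral_congr fun s => ?_
        exact lintegral_indicator_one (s := {x | ENNReal.ofReal s < f x})
          (measurableSet_lt measurable_const hf)

theorem lintegral_rearrangement_le [SFinite ν] (hf : Measurable f) :
    ∫⁻ τ in Ioi (0 : ℝ), rearrangement ν f τ ≤ ∫⁻ x, f x ∂ν := by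
  rw [lintegral_eq_lintegral_measure_ofReal_lt hf,
    lintegral_eq_lintegral_measure_ofReal_lt (measurable_rearrangement ν f)]
  refine lintegral_mono fun s => ?_
  have hm : MeasurableSet {τ | ENNReal.ofReal s < rearrangement ν f τ} :=
    measurableSet_lt measurable_const (measurable_rearrangement ν f)
  rw [Measure.restrict_apply hm]
  set d := ν {x | ENNReal.ofReal s < f x} with hd
  rcases eq_or_ne d ⊤ with h | h
  · rw [h]; exact le_top
  · calc _ ≤ volume (Ioo 0 d.toReal) := by
          refine measure_mono fun τ hτ => ⟨hτ.2, ?_⟩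
          exact (ENNReal.ofReal_lt_iff_lt_toReal (le_of_lt hτ.2) h).1
            (lt_measure_of_lt_rearrangement hτ.1)
      _ = d := by rw [Real.volume_Ioo, sub_zero, ENNReal.ofReal_toReal h]

/-- The easy half of the identity between t f** and the K-functional of (L^1, L^∞): each splitting
into a bounded and an integrable part bounds f**. -/
theorem maximalRearrangement_le_of_add [SFinite ν] {c : ℝ≥0∞} (hf : Measurable f)
    (hg : ∀ x, g x ≤ c + f x) (ht : 0 < t) :
    maximalRearrangement ν g t ≤ c + (∫⁻ x, f x ∂ν) / ENNReal.ofReal t := by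
  have h0 : ENNReal.ofReal t ≠ 0 := by simpa using ht
  have key : ∫⁻ τ in Ioo 0 t, rearrangement ν g τ
      ≤ c * ENNReal.ofReal t + ∫⁻ x, f x ∂ν := by
    calc ∫⁻ τ in Ioo 0 t, rearrangement ν g τ
        ≤ ∫⁻ τ in Ioo 0 t, (c + rearrangement ν f τ) :=
          lintegral_mono fun τ => rearrangement_add_le hg
      _ = c * ENNReal.ofReal t + ∫⁻ τ in Ioo 0 t, rearrangement ν f τ := by
          rw [lintegral_add_left measurable_const, setLIntegral_const, Real.volume_Ioo, sub_zero]
      _ ≤ _ := by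
          gcongr
          exact (lintegral_mono_set Ioo_subset_Ioi_self).trans (lintegral_rearrangement_le hf)
  calc maximalRearrangement ν g t
      ≤ (c * ENNReal.ofReal t + ∫⁻ x, f x ∂ν) / ENNReal.ofReal t := by
        unfold maximalRearrangement; gcongr
    _ = c + (∫⁻ x, f x ∂ν) / ENNReal.ofReal t := by
        rw [ENNReal.add_div, ENNReal.mul_div_cancel_right h0 ENNReal.ofReal_ne_top]

theorem exists_int_mem_Ico_two_zpow {t : ℝ} (ht : 0 < t) :
    ∃ k : ℤ, t ∈ Ico ((2 : ℝ) ^ k) (2 ^ (k + 1)) :=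
  exists_mem_Ico_zpow ht one_lt_two

theorem maximalRearrangement_le_tsum (k : ℤ) (ht : t ∈ Ico ((2 : ℝ) ^ k) (2 ^ (k + 1))) :
    maximalRearrangement ν f t
      ≤ ∑' i : ℕ, (2 : ℝ≥0∞)⁻¹ ^ i * rearrangement ν f (2 ^ (k - i)) := by
  have hk : (0 : ℝ) < 2 ^ k := by positivity
  have hsub : Ioo 0 t ⊆ ⋃ i : ℕ, Ico ((2 : ℝ) ^ (k - i)) (2 ^ (k - i + 1)) := by
    intro τ hτ
    obtain ⟨j, hj⟩ := exists_int_mem_Ico_two_zpow hτ.1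
    have : j ≤ k := by
      have : (2 : ℝ) ^ j < 2 ^ (k + 1) := hj.1.trans_lt (hτ.2.trans ht.2)
      have := (zpow_lt_zpow_iff_right₀ (one_lt_two : (1 : ℝ) < 2)).1 this
      omega
    refine mem_iUnion.2 ⟨(k - j).toNat, ?_⟩
    rw [Int.toNat_of_nonneg (by omega)]
    simpa using hj
  have h1 : ∫⁻ τ in Ioo 0 t, rearrangement ν f τ
      ≤ ∑' i : ℕ, ENNReal.ofReal (2 ^ (k - i)) * rearrangement ν f (2 ^ (k - i)) := by
    refine (lintegral_mono_set hsub).trans ((lintegral_iUnion_le _ _).trans ?_)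
    refine ENNReal.tsum_le_tsum fun i => ?_
    calc ∫⁻ τ in Ico ((2 : ℝ) ^ (k - i)) (2 ^ (k - i + 1)), rearrangement ν f τ
        ≤ ∫⁻ τ in Ico ((2 : ℝ) ^ (k - i)) (2 ^ (k - i + 1)), rearrangement ν f (2 ^ (k - i)) :=
          setLIntegral_mono' measurableSet_Ico fun τ hτ => rearrangement_antitone ν f hτ.1
      _ = _ := by
          rw [setLIntegral_const, Real.volume_Ico, zpow_add_one₀ two_ne_zero, mul_comm]
          congr 2; ring
  have h0 : ENNReal.ofReal (2 ^ k) ≠ 0 := by simpa using hk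
  calc maximalRearrangement ν f t
      ≤ (∑' i : ℕ, ENNReal.ofReal (2 ^ (k - i)) * rearrangement ν f (2 ^ (k - i)))
          / ENNReal.ofReal (2 ^ k) := by
        unfold maximalRearrangement
        gcongr
        exact ht.1
    _ = _ := by
        rw [div_eq_mul_inv, ← ENNReal.tsum_mul_right]
        refine tsum_congr fun i => ?_
        have : ENNReal.ofReal ((2 : ℝ) ^ (k - i)) = ENNReal.ofReal (2 ^ k) * 2⁻¹ ^ i := by
          rw [zpow_sub₀ two_ne_zero, zpow_natCast, div_eq_mul_inv, ENNReal.ofReal_mul hk.le,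
            ENNReal.ofReal_inv_of_pos (by positivity), ENNReal.ofReal_pow zero_le_two,
            ENNReal.inv_pow]
          simp
        rw [this, mul_right_comm, mul_right_comm (ENNReal.ofReal _),
          ENNReal.mul_inv_cancel h0 ENNReal.ofReal_ne_top, one_mul]

end Rearrangement

/-! ### Weighted sequence inequalities and duality in ℓ^q -/

section Sequences

/-- Jensen for the weights κ: Hölder after writing κ = κ^{1/q'} κ^{1/q}. -/
theorem rpow_tsum_mul_le {ι : Type*} (κ x : ι → ℝ≥0∞) {q : ℝ} (hq : 1 ≤ q) :
    (∑' i, κ i * x i) ^ q ≤ (∑' i, κ i) ^ (q - 1) * ∑' i, κ i * x i ^ q := by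
  rcases hq.eq_or_lt with rfl | hq
  · simp
  have hq0 : 0 < q := one_pos.trans hq
  have hc : q.HolderConjugate q.conjExponent := Real.HolderConjugate.conjExponent hq
  set q' := q.conjExponent
  have hlim : Tendsto (fun S : Finset ι => (∑ i ∈ S, κ i * x i) ^ q) atTop
      (𝓝 ((∑' i, κ i * x i) ^ q)) :=
    (ENNReal.continuous_rpow_const.tendsto _).comp ENNReal.summable.hasSum
  refine le_of_tendsto' hlim fun S => ?_
  have h := ENNReal.inner_le_Lp_mul_Lq S (fun i => κ i ^ (1 / q')) (fun i => κ i ^ (1 / q) * x i)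
    hc.symm
  have e1 : ∀ i, κ i ^ (1 / q') * (κ i ^ (1 / q) * x i) = κ i * x i := fun i => by
    rw [← mul_assoc, ← ENNReal.rpow_add_of_nonneg _ _ hc.symm.one_div_nonneg hc.one_div_nonneg]
    have : 1 / q' + 1 / q = 1 := by simpa using hc.symm.inv_add_inv_eq_one
    rw [this, ENNReal.rpow_one]
  have e2 : ∀ i, (κ i ^ (1 / q')) ^ q' = κ i := fun i => by
    rw [← ENNReal.rpow_mul, one_div_mul_cancel hc.symm.ne_zero, ENNReal.rpow_one]
  have e3 : ∀ i, (κ i ^ (1 / q) * x i) ^ q = κ i * x i ^ q := fun i => by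
    rw [ENNReal.mul_rpow_of_nonneg _ _ hq0.le, ← ENNReal.rpow_mul,
      one_div_mul_cancel hq0.ne', ENNReal.rpow_one]
  simp only [e1, e2, e3] at h
  have e4 : 1 / q' * q = q - 1 := by
    rw [one_div, eq_sub_of_add_eq hc.symm.inv_add_inv_eq_one, sub_mul, inv_mul_cancel₀ hq0.ne',
      one_mul]
  calc (∑ i ∈ S, κ i * x i) ^ q
      ≤ ((∑ i ∈ S, κ i) ^ (1 / q') * (∑ i ∈ S, κ i * x i ^ q) ^ (1 / q)) ^ q := by gcongr
    _ = (∑ i ∈ S, κ i) ^ (q - 1) * ∑ i ∈ S, κ i * x i ^ q := by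
        rw [ENNReal.mul_rpow_of_nonneg _ _ hq0.le, ← ENNReal.rpow_mul, ← ENNReal.rpow_mul,
          one_div_mul_cancel hq0.ne', ENNReal.rpow_one, e4]
    _ ≤ _ := by
        gcongr
        · exact ENNReal.sum_le_tsum S
        · exact ENNReal.sum_le_tsum S

open Classical in
/-- The `ℓ^q` (quasi-)norm of a `[0,∞]`-valued sequence indexed by `ℤ`. -/
noncomputable def sequenceNorm (q : ℝ≥0∞) (z : ℤ → ℝ≥0∞) : ℝ≥0∞ :=
  if q = ∞ then ⨆ k, z k else (∑' k, z k ^ q.toReal) ^ (1 / q.toReal)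

theorem sequenceNorm_mono {q : ℝ≥0∞} {z w : ℤ → ℝ≥0∞} (h : ∀ k, z k ≤ w k) :
    sequenceNorm q z ≤ sequenceNorm q w := by
  unfold sequenceNorm
  split_ifs with hq
  · exact iSup_mono h
  · gcongr
    exact h _

theorem sequenceNorm_const_mul {q : ℝ≥0∞} (hq0 : q ≠ 0) (c : ℝ≥0∞) (z : ℤ → ℝ≥0∞) :
    sequenceNorm q (fun k => c * z k) = c * sequenceNorm q z := by
  unfold sequenceNorm
  split_ifs with hq
  · rw [ENNReal.mul_iSup]
  · have h : 0 < q.toReal := ENNReal.toReal_pos hq0 hq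
    simp_rw [ENNReal.mul_rpow_of_nonneg _ _ h.le]
    rw [ENNReal.tsum_mul_left, ENNReal.mul_rpow_of_nonneg _ _ (by positivity),
      ← ENNReal.rpow_mul, mul_one_div_cancel h.ne', ENNReal.rpow_one]

/-- Young's inequality ℓ^1 * ℓ^q ⊂ ℓ^q. With geometric κ it plays the role of Hardy's inequality
throughout. -/
theorem sequenceNorm_convolution_le {q : ℝ≥0∞} (hq : 1 ≤ q) {ι : Type*} (κ : ι → ℝ≥0∞)
    (e : ι → ℤ) (z : ℤ → ℝ≥0∞) :
    sequenceNorm q (fun k => ∑' i, κ i * z (k + e i)) ≤ (∑' i, κ i) * sequenceNorm q z := by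
  unfold sequenceNorm
  split_ifs with h
  · refine iSup_le fun k => ?_
    rw [← ENNReal.tsum_mul_right]
    exact ENNReal.tsum_le_tsum fun i => by gcongr; exact le_iSup z _
  · have hq1 : 1 ≤ q.toReal := by simpa using ENNReal.toReal_mono h hq
    have hq0 : 0 < q.toReal := one_pos.trans_le hq1
    have key : ∑' k, (∑' i, κ i * z (k + e i)) ^ q.toReal
        ≤ (∑' i, κ i) ^ q.toReal * ∑' k, z k ^ q.toReal := by
      calc ∑' k, (∑' i, κ i * z (k + e i)) ^ q.toReal
          ≤ ∑' k, (∑' i, κ i) ^ (q.toReal - 1) * ∑' i, κ i * z (k + e i) ^ q.toReal :=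
            ENNReal.tsum_le_tsum fun k => rpow_tsum_mul_le _ _ hq1
        _ = (∑' i, κ i) ^ (q.toReal - 1) * ∑' i, ∑' k, κ i * z (k + e i) ^ q.toReal := by
            rw [ENNReal.tsum_mul_left, ENNReal.tsum_comm]
        _ = (∑' i, κ i) ^ (q.toReal - 1) * ((∑' i, κ i) * ∑' k, z k ^ q.toReal) := by
            congr 1
            rw [← ENNReal.tsum_mul_right]
            refine tsum_congr fun i => ?_
            rw [ENNReal.tsum_mul_left]
            congr 1
            exact (Equiv.addRight (e i)).tsum_eq fun k => z k ^ q.toReal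
        _ = _ := by
            rw [← mul_assoc]
            congr 1
            nth_rw 2 [← ENNReal.rpow_one (∑' i, κ i)]
            rw [← ENNReal.rpow_add_of_nonneg _ _ (by linarith) zero_le_one]
            simp
    calc _ ≤ ((∑' i, κ i) ^ q.toReal * ∑' k, z k ^ q.toReal) ^ (1 / q.toReal) := by gcongr
      _ = _ := by
        rw [ENNReal.mul_rpow_of_nonneg _ _ (by positivity), ← ENNReal.rpow_mul,
          mul_one_div_cancel hq0.ne', ENNReal.rpow_one]

/-- The converse of Hölder's inequality for sequences. -/
theorem tsum_rpow_le_of_forall_tsum_mul_le {q σ : ℝ} (h : q.HolderConjugate σ) {x : ℤ → ℝ≥0∞}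
    {C : ℝ≥0∞} (hC : C ≠ ∞) (hx : ∀ b : ℤ → ℝ≥0∞, ∑' k, b k ^ q ≤ 1 → ∑' k, b k * x k ≤ C) :
    ∑' k, x k ^ σ ≤ C ^ σ := by
  classical
  have hxk : ∀ k, x k ≠ ∞ := by
    intro k
    have := hx (Pi.single k 1) (by
      rw [tsum_eq_single k]
      · simp
      · intro j hj; simp [hj, h.pos])
    rw [tsum_eq_single k] at this
    · exact ne_top_of_le_ne_top hC (by simpa using this)
    · intro j hj; simp [hj]
  rw [ENNReal.tsum_eq_iSup_sum]
  refine iSup_le fun F => ?_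
  set S := ∑ k ∈ F, x k ^ σ with hS
  rcases eq_or_ne S 0 with h0 | h0
  · rw [h0]; exact bot_le
  have hST : S ≠ ∞ := by
    rw [hS]
    exact (ENNReal.sum_lt_top.2 fun k _ =>
      ENNReal.rpow_lt_top_of_nonneg h.symm.nonneg (hxk k)).ne
  have hsq : (σ - 1) * q = σ := h.symm.sub_one_mul_conj
  -- The extremal sequence for Hölder, truncated to `F` and normalized in ℓ^q.
  have h1 := hx (fun k => if k ∈ F then x k ^ (σ - 1) * S ^ (-(1 / q)) else 0) (by
    rw [tsum_eq_sum (s := F) (by intro k hk; simp [hk, h.pos])]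
    calc _ = ∑ k ∈ F, x k ^ σ * S⁻¹ := by
          refine Finset.sum_congr rfl fun k hk => ?_
          rw [if_pos hk, ENNReal.mul_rpow_of_nonneg _ _ h.nonneg, ← ENNReal.rpow_mul, hsq,
            ← ENNReal.rpow_mul, neg_mul, one_div_mul_cancel h.ne_zero, ENNReal.rpow_neg_one]
      _ = 1 := by rw [← Finset.sum_mul, ENNReal.mul_inv_cancel h0 hST]
      _ ≤ 1 := le_rfl)
  rw [tsum_eq_sum (s := F) (by intro k hk; simp [hk])] at h1
  have h2 : ∑ k ∈ F, (if k ∈ F then x k ^ (σ - 1) * S ^ (-(1 / q)) else 0) * x k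
      = S ^ (1 / σ) := by
    calc _ = ∑ k ∈ F, x k ^ σ * S ^ (-(1 / q)) := by
          refine Finset.sum_congr rfl fun k hk => ?_
          rw [if_pos hk, mul_right_comm]
          congr 1
          nth_rw 2 [← ENNReal.rpow_one (x k)]
          rw [← ENNReal.rpow_add_of_nonneg _ _ (sub_nonneg.2 h.symm.lt.le) zero_le_one]
          simp
      _ = S ^ (1 : ℝ) * S ^ (-(1 / q)) := by rw [← Finset.sum_mul, ENNReal.rpow_one]
      _ = _ := by
          rw [← ENNReal.rpow_add _ _ h0 hST]
          congr 1
          have := h.inv_add_inv_eq_one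
          simp only [one_div]; linarith
  rw [h2] at h1
  calc S = (S ^ (1 / σ)) ^ σ := by
        rw [← ENNReal.rpow_mul, one_div_mul_cancel h.symm.ne_zero, ENNReal.rpow_one]
    _ ≤ C ^ σ := by gcongr; exact h.symm.nonneg

theorem le_of_forall_tsum_mul_le {q : ℝ} (hq : 0 < q) {x : ℤ → ℝ≥0∞} {C : ℝ≥0∞}
    (hx : ∀ b : ℤ → ℝ≥0∞, ∑' k, b k ^ q ≤ 1 → ∑' k, b k * x k ≤ C) (k : ℤ) : x k ≤ C := by
  classical
  have := hx (Pi.single k 1) (by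
    rw [tsum_eq_single k]
    · simp
    · intro j hj; simp [hj, hq])
  rwa [tsum_eq_single k (by intro j hj; simp [hj]), Pi.single_eq_same, one_mul] at this

theorem tsum_rpow_natCast_mul_ne_top {δ : ℝ} (hδ : δ < 0) :
    ∑' n : ℕ, (2 : ℝ≥0∞) ^ (n * δ) ≠ ∞ := by
  have h : ∀ n : ℕ, (2 : ℝ≥0∞) ^ (n * δ) = ((2 : ℝ≥0∞) ^ δ) ^ n := fun n => by
    rw [mul_comm, ENNReal.rpow_mul, ENNReal.rpow_natCast]
  simp_rw [h]
  rw [ENNReal.tsum_geometric, ENNReal.inv_ne_top]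
  refine (tsub_pos_of_lt ?_).ne'
  exact ENNReal.rpow_lt_one_of_one_lt_of_neg (by norm_num) hδ

end Sequences

/-! ### Discretization of L^q(dt/t) -/

section Dyadic

theorem haarHalfLine_Ico_le (k : ℤ) : haarHalfLine (Ico ((2 : ℝ) ^ k) (2 ^ (k + 1))) ≤ 1 := by
  have hk : (0 : ℝ) < 2 ^ k := by positivity
  have h0 : ENNReal.ofReal (2 ^ k) ≠ 0 := by simpa using hk
  unfold haarHalfLine
  rw [withDensity_apply _ measurableSet_Ico, Measure.restrict_restrict measurableSet_Ico]
  calc _ ≤ ∫⁻ t in Ico ((2 : ℝ) ^ k) (2 ^ (k + 1)) ∩ Ioi 0, (ENNReal.ofReal (2 ^ k))⁻¹ := by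
        refine setLIntegral_mono' (measurableSet_Ico.inter measurableSet_Ioi) fun t ht => ?_
        gcongr
        exact ht.1.1
    _ ≤ (ENNReal.ofReal (2 ^ k))⁻¹ * volume (Ico ((2 : ℝ) ^ k) (2 ^ (k + 1))) := by
        rw [setLIntegral_const]
        gcongr
        exact inter_subset_left
    _ = 1 := by
        rw [Real.volume_Ico, zpow_add_one₀ two_ne_zero, mul_two, add_sub_cancel_right,
          ENNReal.inv_mul_cancel h0 ENNReal.ofReal_ne_top]

theorem ae_haarHalfLine_pos : ∀ᵐ t ∂haarHalfLine, 0 < t :=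
  (withDensity_absolutelyContinuous _ _).ae_le (ae_restrict_mem measurableSet_Ioi)

theorem ofReal_two_zpow_eq (k : ℤ) : ENNReal.ofReal ((2 : ℝ) ^ k) = (2 : ℝ≥0∞) ^ (k : ℝ) := by
  rw [← Real.rpow_intCast, ← ENNReal.ofReal_rpow_of_pos two_pos]
  simp

theorem eLpNorm_haarHalfLine_le {s : ℝ} (hs : 0 < s) {q : ℝ≥0∞} (hq0 : q ≠ 0)
    {T : ℝ → ℝ≥0∞} {U : ℤ → ℝ≥0∞}
    (h : ∀ k : ℤ, ∀ t ∈ Ico ((2 : ℝ) ^ k) (2 ^ (k + 1)), T t ≤ U k) :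
    eLpNorm (fun t : ℝ => ENNReal.ofReal (t ^ (1 / s)) * T t) q haarHalfLine
      ≤ 2 ^ (1 / s) * sequenceNorm q fun k => 2 ^ (k / s) * U k := by
  have hpt : ∀ k : ℤ, ∀ t ∈ Ico ((2 : ℝ) ^ k) (2 ^ (k + 1)),
      ENNReal.ofReal (t ^ (1 / s)) * T t ≤ 2 ^ (1 / s) * (2 ^ (k / s) * U k) := by
    intro k t ht
    rw [← mul_assoc]
    gcongr
    · have ht0 : 0 ≤ t := le_trans (by positivity) ht.1
      rw [← ENNReal.ofReal_rpow_of_nonneg ht0 (by positivity)]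
      calc ENNReal.ofReal t ^ (1 / s) ≤ ENNReal.ofReal (2 ^ (k + 1)) ^ (1 / s) := by
            gcongr
            exact ht.2.le
        _ = 2 ^ (1 / s) * 2 ^ (k / s) := by
            rw [ofReal_two_zpow_eq, ← ENNReal.rpow_mul,
              ← ENNReal.rpow_add _ _ two_ne_zero ENNReal.ofNat_ne_top]
            congr 1
            push_cast
            ring
    · exact h k t ht
  rw [← sequenceNorm_const_mul hq0]
  unfold sequenceNorm
  split_ifs with hq
  · rw [hq, eLpNorm_exponent_top]
    refine essSup_le_of_ae_le _ ?_
    filter_upwards [ae_haarHalfLine_pos] with t ht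
    obtain ⟨k, hk⟩ := exists_int_mem_Ico_two_zpow ht
    exact (hpt k t hk).trans (le_iSup (fun k : ℤ => (2 : ℝ≥0∞) ^ (1 / s) * (2 ^ (k / s) * U k)) k)
  · rw [eLpNorm_eq_lintegral_rpow_enorm_toReal hq0 hq]
    gcongr
    calc _ ≤ ∫⁻ t, ∑' k : ℤ, (Ico ((2 : ℝ) ^ k) (2 ^ (k + 1))).indicator
          (fun _ => (2 ^ (1 / s) * (2 ^ (k / s) * U k)) ^ q.toReal) t ∂haarHalfLine := by
          refine lintegral_mono_ae ?_
          filter_upwards [ae_haarHalfLine_pos] with t ht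
          obtain ⟨k, hk⟩ := exists_int_mem_Ico_two_zpow ht
          refine le_trans ?_ (ENNReal.le_tsum k)
          rw [indicator_of_mem hk]
          gcongr
          exact hpt k t hk
      _ = ∑' k : ℤ, (2 ^ (1 / s) * (2 ^ (k / s) * U k)) ^ q.toReal
            * haarHalfLine (Ico ((2 : ℝ) ^ k) (2 ^ (k + 1))) := by
          rw [lintegral_tsum fun k => (measurable_const.indicator measurableSet_Ico).aemeasurable]
          exact tsum_congr fun k => lintegral_indicator_const measurableSet_Ico _
      _ ≤ _ := ENNReal.tsum_le_tsum fun k => mul_le_of_le_one_right' (haarHalfLine_Ico_le k)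

end Dyadic

/-! ### The J-method ball, its embedding in L^{s,q}, and its polar -/

section InterpolationBall

variable {X : Type*} [MeasurableSpace X] {ν : Measure X} {s q : ℝ}

/-- `f = ∑ φ k`, where `φ k` is bounded by `2^{-k/s} b k` and has integral at most
`2^{k(1-1/s)} b k`. -/
structure IsDyadicDecomposition (ν : Measure X) (s : ℝ) (b : ℤ → ℝ≥0∞) (φ : ℤ → X → ℝ≥0∞)
    (f : X → ℝ≥0∞) : Prop where
  measurable : ∀ k, Measurable (φ k)
  le : ∀ k x, φ k x ≤ 2 ^ (-(k / s)) * b k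
  lintegral_le : ∀ k, ∫⁻ x, φ k x ∂ν ≤ 2 ^ (k * (1 - 1 / s)) * b k
  eq_tsum : ∀ x, f x = ∑' k, φ k x

/-- The unit ball of the discrete `J`-method interpolation space between `L^1` and `L^∞`,
which is contained in a ball of `L^{s,q}`. -/
def interpolationBall (ν : Measure X) (s q : ℝ) : Set (X → ℝ≥0∞) :=
  {f | ∃ b φ, ∑' k, b k ^ q ≤ 1 ∧ IsDyadicDecomposition ν s b φ f}

theorem IsDyadicDecomposition.measurable_sum {b : ℤ → ℝ≥0∞} {φ : ℤ → X → ℝ≥0∞}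
    {f : X → ℝ≥0∞} (h : IsDyadicDecomposition ν s b φ f) : Measurable f := by
  rw [show f = fun x => ∑' k, φ k x from funext h.eq_tsum]
  exact Measurable.tsum h.measurable

theorem measurable_of_mem_interpolationBall {f : X → ℝ≥0∞} (h : f ∈ interpolationBall ν s q) :
    Measurable f := by
  obtain ⟨b, φ, -, h⟩ := h
  exact h.measurable_sum

theorem IsDyadicDecomposition.const_mul {b : ℤ → ℝ≥0∞} {φ : ℤ → X → ℝ≥0∞}
    {f : X → ℝ≥0∞} (h : IsDyadicDecomposition ν s b φ f) (c : ℝ≥0∞) :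
    IsDyadicDecomposition ν s (fun k => c * b k) (fun k x => c * φ k x) (fun x => c * f x) where
  measurable k := (h.measurable k).const_mul c
  le k x := by
    rw [mul_left_comm]
    gcongr
    exact h.le k x
  lintegral_le k := by
    rw [mul_left_comm, lintegral_const_mul _ (h.measurable k)]
    gcongr
    exact h.lintegral_le k
  eq_tsum x := by rw [h.eq_tsum, ENNReal.tsum_mul_left]

theorem zero_mem_interpolationBall (hq : 0 < q) : (0 : X → ℝ≥0∞) ∈ interpolationBall ν s q :=
  ⟨0, 0, by simp [hq], fun _ => measurable_zero, by simp, by simp, by simp⟩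

/-- Countable convexity: decompositions are added scale by scale, and Jensen keeps the coefficients
in the ℓ^q ball. This exact stability, without loss of a constant, is what the capacity and
Hahn-Banach arguments need. -/
theorem tsum_mul_mem_interpolationBall {ι : Type*} [Countable ι] (hq : 1 ≤ q) {θ : ι → ℝ≥0∞}
    (hθ : ∑' i, θ i ≤ 1) {f : ι → X → ℝ≥0∞} (hf : ∀ i, f i ∈ interpolationBall ν s q) :
    (fun x => ∑' i, θ i * f i x) ∈ interpolationBall ν s q := by
  choose b φ hb h using hf
  refine ⟨fun k => ∑' i, θ i * b i k, fun k x => ∑' i, θ i * φ i k x, ?_, ?_, ?_, ?_, ?_⟩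
  · calc ∑' k, (∑' i, θ i * b i k) ^ q
        ≤ ∑' k, ∑' i, θ i * b i k ^ q := by
          refine ENNReal.tsum_le_tsum fun k => (rpow_tsum_mul_le _ _ hq).trans ?_
          exact mul_le_of_le_one_left' (ENNReal.rpow_le_one hθ (sub_nonneg.2 hq))
      _ = ∑' i, θ i * ∑' k, b i k ^ q := by
          rw [ENNReal.tsum_comm]
          simp_rw [ENNReal.tsum_mul_left]
      _ ≤ ∑' i, θ i := ENNReal.tsum_le_tsum fun i => mul_le_of_le_one_right' (hb i)
      _ ≤ 1 := hθ
  · exact fun k => Measurable.tsum fun i => ((h i).measurable k).const_mul _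
  · intro k x
    rw [← ENNReal.tsum_mul_left]
    refine ENNReal.tsum_le_tsum fun i => ?_
    rw [mul_left_comm]
    gcongr
    exact (h i).le k x
  · intro k
    rw [lintegral_tsum fun i => (((h i).measurable k).const_mul _).aemeasurable,
      ← ENNReal.tsum_mul_left]
    refine ENNReal.tsum_le_tsum fun i => ?_
    rw [mul_left_comm, lintegral_const_mul _ ((h i).measurable k)]
    gcongr
    exact (h i).lintegral_le k
  · intro x
    rw [ENNReal.tsum_comm]
    refine tsum_congr fun i => ?_
    rw [ENNReal.tsum_mul_left, (h i).eq_tsum]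

/-- For t of size 2^j, the pieces with k > j are estimated by their supremum and those with k ≤ j by
their integral divided by t. Both give a factor decaying geometrically in |k - j|, because 0 < 1/s <
1, so the coefficients are convolved with an ℓ^1 kernel. -/
theorem exists_lorentzNorm_le_sequenceNorm [SFinite ν] (hs : 1 < s) :
    ∃ C : ℝ≥0∞, C ≠ ∞ ∧ ∀ q : ℝ≥0∞, 1 ≤ q → ∀ b φ f, IsDyadicDecomposition ν s b φ f →
      lorentzNorm ν s q f ≤ C * sequenceNorm q b := by
  have hs0 : 0 < s := one_pos.trans hs
  have hs1 : 0 < 1 - 1 / s := by rw [sub_pos, div_lt_one hs0]; exact hs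
  set κ : ℤ → ℝ≥0∞ := fun i => if 0 < i then 2 ^ (-(i / s)) else 2 ^ (i * (1 - 1 / s)) with hκ
  have hκT : ∑' i, κ i ≠ ∞ := by
    rw [tsum_of_nat_of_neg_add_one ENNReal.summable ENNReal.summable]
    refine ENNReal.add_ne_top.2 ⟨?_, ?_⟩
    · refine ne_top_of_le_ne_top
        (tsum_rpow_natCast_mul_ne_top (δ := -(1 / s)) (by simpa using hs0))
        (ENNReal.tsum_le_tsum fun n => ?_)
      rcases n.eq_zero_or_pos with rfl | hn
      · simp [hκ]
      · rw [hκ]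
        simp only [Int.natCast_pos, hn, if_true, Int.cast_natCast]
        apply le_of_eq
        congr 1
        ring
    · refine ne_top_of_le_ne_top
        (tsum_rpow_natCast_mul_ne_top (δ := -(1 - 1 / s)) (by simpa using hs1))
        (ENNReal.tsum_le_tsum fun n => ?_)
      rw [hκ]
      simp only [show ¬ (0 : ℤ) < -((n : ℤ) + 1) by omega, if_false]
      refine ENNReal.rpow_le_rpow_of_exponent_le (by norm_num) ?_
      push_cast
      nlinarith
  refine ⟨2 ^ (1 / s) * ∑' i, κ i, ENNReal.mul_ne_top (by simp) hκT, ?_⟩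
  intro q hq b φ f h
  have hpt : ∀ j : ℤ, ∀ t ∈ Ico ((2 : ℝ) ^ j) (2 ^ (j + 1)),
      maximalRearrangement ν f t ≤ 2 ^ (-(j / s)) * ∑' i, κ i * b (j + i) := by
    intro j t ht
    have hj : (0 : ℝ) < 2 ^ j := by positivity
    have ht0 : 0 < t := hj.trans_le ht.1
    have hle : ∀ x, f x ≤ (∑' k : ℤ, if j < k then 2 ^ (-(k / s)) * b k else 0)
        + ∑' k : ℤ, if j < k then 0 else φ k x := by
      intro x
      rw [h.eq_tsum, ← ENNReal.tsum_add]
      refine ENNReal.tsum_le_tsum fun k => ?_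
      split_ifs
      · simpa using h.le k x
      · simp
    have hm : ∀ k : ℤ, Measurable fun x => if j < k then 0 else φ k x := by
      intro k
      split_ifs
      · exact measurable_const
      · exact h.measurable k
    refine (maximalRearrangement_le_of_add (Measurable.tsum hm) hle ht0).trans ?_
    rw [lintegral_tsum fun k => (hm k).aemeasurable, div_eq_mul_inv, ← ENNReal.tsum_mul_right,
      ← ENNReal.tsum_add, ← ENNReal.tsum_mul_left, ← (Equiv.addLeft j).tsum_eq]
    refine ENNReal.tsum_le_tsum fun i => ?_
    rw [Equiv.coe_addLeft, ← mul_assoc]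
    by_cases hi : 0 < i
    · have : j < j + i := by omega
      simp only [hκ, this, hi, if_true, lintegral_zero, zero_mul, add_zero]
      rw [← ENNReal.rpow_add _ _ two_ne_zero ENNReal.ofNat_ne_top]
      gcongr
      · norm_num
      · push_cast
        apply le_of_eq
        ring
    · have : ¬ j < j + i := by omega
      simp only [hκ, this, hi, if_false, zero_add]
      calc (∫⁻ x, φ (j + i) x ∂ν) * (ENNReal.ofReal t)⁻¹
          ≤ (2 ^ (((j + i : ℤ) : ℝ) * (1 - 1 / s)) * b (j + i)) * (ENNReal.ofReal (2 ^ j))⁻¹ := by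
            gcongr
            · exact h.lintegral_le _
            · exact ht.1
        _ = _ := by
            rw [mul_right_comm, ofReal_two_zpow_eq, ← ENNReal.rpow_neg,
              ← ENNReal.rpow_add _ _ two_ne_zero ENNReal.ofNat_ne_top,
              ← ENNReal.rpow_add _ _ two_ne_zero ENNReal.ofNat_ne_top]
            congr 2
            push_cast
            ring
  unfold lorentzNorm
  rw [if_pos ⟨hs, hq⟩]
  have hq0 : q ≠ 0 := (one_pos.trans_le hq).ne'
  refine (eLpNorm_haarHalfLine_le hs0 hq0 hpt).trans ?_
  rw [mul_assoc]
  gcongr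
  refine le_trans (sequenceNorm_mono fun k => le_of_eq ?_) (sequenceNorm_convolution_le hq κ id b)
  rw [← mul_assoc, ← ENNReal.rpow_add _ _ two_ne_zero ENNReal.ofNat_ne_top, add_neg_cancel,
    ENNReal.rpow_zero, one_mul]
  rfl

/-- Tests `P` against a combination of indicators of superlevel sets {P > H_k}, which have measure
above 2^k. Levels strictly below the rearrangement make that inequality available. -/
theorem tsum_mul_rearrangement_le [SigmaFinite ν] {P : X → ℝ≥0∞} (hPm : Measurable P)
    {C : ℝ≥0∞} (hP : ∀ f ∈ interpolationBall ν s q, ∫⁻ x, f x * P x ∂ν ≤ C)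
    {b : ℤ → ℝ≥0∞} (hb : ∑' k, b k ^ q ≤ 1) {H : ℤ → ℝ≥0∞}
    (hH : ∀ k, H k = 0 ∨ H k < rearrangement ν P (2 ^ k)) :
    ∑' k : ℤ, b k * (2 ^ (k * (1 - 1 / s)) * H k) ≤ C := by
  have hA : ∀ k : ℤ, ∃ A, MeasurableSet A ∧ (∀ x ∈ A, H k ≤ P x) ∧
      (H k ≠ 0 → (2 : ℝ≥0∞) ^ (k : ℝ) < ν A) ∧ ν A < ∞ := by
    intro k
    rcases hH k with h | h
    · exact ⟨∅, MeasurableSet.empty, by simp, fun h' => absurd h h', by simp⟩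
    · have h' := lt_measure_of_lt_rearrangement h
      rw [ofReal_two_zpow_eq] at h'
      obtain ⟨A, hA, hsub, hlt, hfin⟩ :=
        Measure.exists_subset_measure_lt_top (measurableSet_lt measurable_const hPm) h'
      exact ⟨A, hA, fun x hx => (hsub hx).le, fun _ => hlt, hfin⟩
  choose A hAm hAP hAlt hAfin using hA
  -- The measure of `A k` may far exceed 2^k and the space may have atoms; the weight lowers the
  -- mass to exactly 2^k without shrinking the set.
  set θ : ℤ → ℝ≥0∞ := fun k => if H k = 0 then 0 else 2 ^ (k : ℝ) / ν (A k) with hθ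
  have hθ1 : ∀ k, θ k ≤ 1 := by
    intro k
    simp only [hθ]
    split_ifs with h
    · exact zero_le_one
    · exact ENNReal.div_le_of_le_mul (by simpa using (hAlt k h).le)
  have hθν : ∀ k, H k ≠ 0 → θ k * ν (A k) = 2 ^ (k : ℝ) := by
    intro k h
    simp only [hθ, h, if_false]
    exact ENNReal.div_mul_cancel (ne_of_gt (bot_le.trans_lt (hAlt k h))) (hAfin k).ne
  have hθν' : ∀ k, θ k * ν (A k) ≤ 2 ^ (k : ℝ) := by
    intro k
    by_cases h : H k = 0
    · simp [hθ, h]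
    · exact (hθν k h).le
  set φ : ℤ → X → ℝ≥0∞ := fun k => (A k).indicator fun _ => 2 ^ (-(k / s)) * b k * θ k with hφ
  have hexp : ∀ k : ℤ, (2 : ℝ≥0∞) ^ (-(k / s)) * 2 ^ (k : ℝ) = 2 ^ (k * (1 - 1 / s)) := by
    intro k
    rw [← ENNReal.rpow_add _ _ two_ne_zero ENNReal.ofNat_ne_top]
    congr 1
    ring
  have hφm : ∀ k, Measurable (φ k) := fun k => measurable_const.indicator (hAm k)
  have hmem : (fun x => ∑' k, φ k x) ∈ interpolationBall ν s q := by
    refine ⟨b, φ, hb, hφm, fun k x => ?_, fun k => ?_, fun x => rfl⟩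
    · refine (indicator_le_self' (fun _ _ => bot_le) x).trans ?_
      exact mul_le_of_le_one_right' (hθ1 k)
    · rw [hφ, lintegral_indicator_const (hAm k), mul_assoc, ← hexp]
      calc _ ≤ (2 : ℝ≥0∞) ^ (-(k / s)) * b k * 2 ^ (k : ℝ) := by gcongr; exact hθν' k
        _ = _ := by ring
  refine le_trans ?_ (hP _ hmem)
  have : ∀ x, (∑' k, φ k x) * P x = ∑' k, φ k x * P x := fun x => ENNReal.tsum_mul_right.symm
  simp_rw [this]
  rw [lintegral_tsum (f := fun k x => φ k x * P x) fun k => ((hφm k).mul hPm).aemeasurable]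
  refine ENNReal.tsum_le_tsum fun k => ?_
  by_cases h : H k = 0
  · simp [h]
  calc b k * (2 ^ (k * (1 - 1 / s)) * H k)
      = ∫⁻ x, (A k).indicator (fun _ => 2 ^ (-(k / s)) * b k * θ k * H k) x ∂ν := by
        rw [lintegral_indicator_const (hAm k), ← hexp, ← hθν k h]
        ring
    _ ≤ _ := by
        refine lintegral_mono fun x => ?_
        by_cases hx : x ∈ A k
        · simp only [hφ, indicator_of_mem hx]
          gcongr
          exact hAP k x hx
        · simp [indicator_of_notMem hx]

theorem sequenceNorm_rearrangement_lt_top [SigmaFinite ν] {P : X → ℝ≥0∞} (hPm : Measurable P)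
    {C : ℝ≥0∞} (hC : C ≠ ∞) (hP : ∀ f ∈ interpolationBall ν s q, ∫⁻ x, f x * P x ∂ν ≤ C)
    {σ : ℝ≥0∞} (hq : 0 < q)
    (hσ : σ = ∞ ∨ ∃ τ : ℝ, q.HolderConjugate τ ∧ σ = ENNReal.ofReal τ) :
    sequenceNorm σ (fun k => 2 ^ (k * (1 - 1 / s)) * rearrangement ν P (2 ^ k)) < ∞ := by
  classical
  have hbdd : ∀ k : ℤ, (2 : ℝ≥0∞) ^ (k * (1 - 1 / s)) * rearrangement ν P (2 ^ k) ≤ C := by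
    intro k
    have h20 : (2 : ℝ≥0∞) ^ ((k : ℝ) * (1 - 1 / s)) ≠ 0 := by simp
    have h2T : (2 : ℝ≥0∞) ^ ((k : ℝ) * (1 - 1 / s)) ≠ ∞ := by simp
    rw [mul_comm, ← ENNReal.le_div_iff_mul_le (Or.inl h20) (Or.inl h2T)]
    refine le_of_forall_lt_imp_le_of_dense fun h hh => ?_
    rw [ENNReal.le_div_iff_mul_le (Or.inl h20) (Or.inl h2T), mul_comm]
    -- A single nonzero level suffices for the supremum bound. It also shows that the rearrangement
    -- is finite at every 2^k, so that half of it is an admissible level below.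
    have := le_of_forall_tsum_mul_le hq
      (fun b hb => tsum_mul_rearrangement_le hPm hP hb (H := Pi.single k h) (by
        intro j
        by_cases hj : j = k
        · subst hj; right; simpa using hh
        · left; simp [hj])) k
    simpa using this
  unfold sequenceNorm
  rcases hσ with rfl | ⟨τ, hτ, rfl⟩
  · rw [if_pos rfl]
    exact (iSup_le hbdd).trans_lt hC.lt_top
  · rw [if_neg ENNReal.ofReal_ne_top, ENNReal.toReal_ofReal hτ.symm.nonneg]
    have hfin : ∀ k : ℤ, rearrangement ν P (2 ^ k) ≠ ∞ := by
      intro k h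
      have := hbdd k
      rw [h, ENNReal.mul_top (by simp), top_le_iff] at this
      exact hC this
    have h := tsum_rpow_le_of_forall_tsum_mul_le hτ hC fun b hb =>
      tsum_mul_rearrangement_le hPm hP hb (H := fun k => rearrangement ν P (2 ^ k) / 2) (by
        intro k
        by_cases h0 : rearrangement ν P (2 ^ k) = 0
        · left; simp [h0]
        · right; exact ENNReal.half_lt_self h0 (hfin k))
    have h3 : ∀ k : ℤ, ((2 : ℝ≥0∞) ^ (k * (1 - 1 / s)) * rearrangement ν P (2 ^ k)) ^ τ
        = 2 ^ τ * (2 ^ (k * (1 - 1 / s)) * (rearrangement ν P (2 ^ k) / 2)) ^ τ := by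
      intro k
      rw [← ENNReal.mul_rpow_of_nonneg _ _ hτ.symm.nonneg]
      congr 1
      rw [mul_left_comm, ENNReal.mul_div_cancel two_ne_zero ENNReal.ofNat_ne_top]
    simp_rw [h3]
    rw [ENNReal.tsum_mul_left]
    refine ENNReal.rpow_lt_top_of_nonneg (by have := hτ.symm.nonneg; positivity) ?_
    refine ENNReal.mul_ne_top (by simp)
      (ne_top_of_le_ne_top ?_ h)
    exact ENNReal.rpow_ne_top_of_nonneg hτ.symm.nonneg hC

end InterpolationBall

/-! ### From boundedness in measure to boundedness in L^1 (Nikishin-Maurey) -/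

section Factorization

variable {X : Type*} [MeasurableSpace X]

theorem lintegral_eq_iSup_lintegral_min_natCast {ν : Measure X} {u : X → ℝ≥0∞}
    (hu : Measurable u) : ∫⁻ x, u x ∂ν = ⨆ n : ℕ, ∫⁻ x, min (u x) n ∂ν := by
  rw [← lintegral_iSup]
  · refine lintegral_congr fun x => ?_
    rw [← inf_iSup_eq, ENNReal.iSup_natCast, inf_top_eq]
  · exact fun n => hu.min measurable_const
  · intro m n hmn x
    exact min_le_min le_rfl (by exact_mod_cast hmn)

/-- A convex set of nonnegative functions which is bounded in measure is bounded in `L^1(E)` for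
some set `E` of positive measure. -/
theorem exists_setLIntegral_le_of_bounded_in_measure (ν : Measure X) [IsFiniteMeasure ν]
    (hν : ν univ ≠ 0) {𝓕 : Set (X → ℝ≥0∞)} (hne : 𝓕.Nonempty) (hmeas : ∀ u ∈ 𝓕, Measurable u)
    (hconv : ∀ u ∈ 𝓕, ∀ v ∈ 𝓕, ∀ a b : ℝ≥0∞, a + b = 1 → (fun x => a * u x + b * v x) ∈ 𝓕)
    {M : ℝ} (hM0 : 0 ≤ M) (hM : ∀ u ∈ 𝓕, ν {x | ENNReal.ofReal M < u x} ≤ ν univ / 2) :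
    ∃ E, MeasurableSet E ∧ ν E ≠ 0 ∧ ∃ C ≠ ∞, ∀ u ∈ 𝓕, ∫⁻ x in E, u x ∂ν ≤ C := by
  -- The L^2 functions dominated by a member of `𝓕`: convex, and containing truncations of members,
  -- which need not be in L^2 themselves.
  set A : Set (Lp ℝ 2 ν) := {w | ∃ u ∈ 𝓕, ∀ᵐ x ∂ν, ENNReal.ofReal (w x) ≤ u x} with hA
  have hAconv : Convex ℝ A := by
    rintro w ⟨u, hu, hwu⟩ w' ⟨v, hv, hwv⟩ a b ha hb hab
    refine ⟨_, hconv u hu v hv (ENNReal.ofReal a) (ENNReal.ofReal b) (by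
      rw [← ENNReal.ofReal_add ha hb, hab, ENNReal.ofReal_one]), ?_⟩
    filter_upwards [hwu, hwv, Lp.coeFn_add (a • w) (b • w'), Lp.coeFn_smul a w,
      Lp.coeFn_smul b w'] with x h1 h2 h3 h4 h5
    rw [h3, Pi.add_apply, h4, h5, Pi.smul_apply, Pi.smul_apply, smul_eq_mul, smul_eq_mul]
    refine ENNReal.ofReal_add_le.trans ?_
    rw [ENNReal.ofReal_mul ha, ENNReal.ofReal_mul hb]
    gcongr
  have h0A : (0 : Lp ℝ 2 ν) ∈ A := by
    obtain ⟨u, hu⟩ := hne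
    refine ⟨u, hu, ?_⟩
    filter_upwards [Lp.coeFn_zero ℝ 2 ν] with x hx
    rw [hx]
    simp
  set w₀ : Lp ℝ 2 ν := (memLp_const (M + 1)).toLp (fun _ => M + 1) with hw₀
  have hw₀x : ∀ᵐ x ∂ν, w₀ x = M + 1 := MemLp.coeFn_toLp _
  set ρ : ℝ≥0∞ := (ν univ / 2) ^ (1 / (2 : ℝ)) with hρ
  have hhalf0 : ν univ / 2 ≠ 0 := by simpa using hν
  have hhalfT : ν univ / 2 ≠ ∞ := ENNReal.div_ne_top (measure_ne_top _ _) two_ne_zero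
  have hρT : ρ ≠ ∞ := ENNReal.rpow_ne_top_of_nonneg (by norm_num) hhalfT
  have hρ0 : 0 < ρ.toReal :=
    ENNReal.toReal_pos (by rw [hρ]; exact (ENNReal.rpow_pos (pos_iff_ne_zero.2 hhalf0) hhalfT).ne')
      hρT
  -- If w ≤ u with u in `𝓕`, then w ≤ M on a set of at least half the mass, where the constant M + 1
  -- exceeds w by at least 1. Hence the L^2 distance is at least (ν(X)/2)^{1/2}, the chosen radius.
  have hdisj : Disjoint (Metric.ball w₀ ρ.toReal) A := by
    rw [Set.disjoint_left]
    rintro w hw ⟨u, hu, hwu⟩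
    have hset : MeasurableSet {x | u x ≤ ENNReal.ofReal M} :=
      measurableSet_le (hmeas u hu) measurable_const
    have hmass : ν univ / 2 ≤ ν {x | u x ≤ ENNReal.ofReal M} := by
      have h1 : {x | u x ≤ ENNReal.ofReal M}ᶜ = {x | ENNReal.ofReal M < u x} := by
        ext x; simp
      have h2 := measure_add_measure_compl (μ := ν) hset
      rw [h1] at h2
      by_contra! h3
      have h4 := ENNReal.add_lt_add_of_lt_of_le (ne_top_of_le_ne_top hhalfT (hM u hu)) h3 (hM u hu)
      rw [h2, ENNReal.add_halves] at h4
      exact lt_irrefl _ h4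
    have hle : ρ ≤ eLpNorm (w - w₀) 2 ν := by
      calc ρ ≤ ν {x | u x ≤ ENNReal.ofReal M} ^ (1 / (2 : ℝ)) := by
            rw [hρ]; gcongr
        _ = eLpNorm ({x | u x ≤ ENNReal.ofReal M}.indicator fun _ => (1 : ℝ)) 2 ν := by
            rw [eLpNorm_indicator_const hset two_ne_zero ENNReal.ofNat_ne_top]
            simp
        _ ≤ eLpNorm (w - w₀) 2 ν := by
            refine eLpNorm_mono_ae ?_
            filter_upwards [hwu, hw₀x, Lp.coeFn_sub w w₀] with x h1 h2 h3
            by_cases hx : u x ≤ ENNReal.ofReal M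
            · rw [indicator_of_mem (show x ∈ {x | u x ≤ ENNReal.ofReal M} from hx), h3,
                Pi.sub_apply, h2, norm_one, Real.norm_eq_abs]
              have h4 : w x ≤ M := (ENNReal.ofReal_le_ofReal_iff hM0).1 (h1.trans hx)
              rw [abs_sub_comm]
              exact le_trans (by linarith) (le_abs_self _)
            · rw [indicator_of_notMem (show x ∉ {x | u x ≤ ENNReal.ofReal M} from hx), norm_zero]
              exact norm_nonneg _
    rw [Metric.mem_ball, dist_eq_norm, Lp.norm_def,
      ENNReal.toReal_lt_toReal (Lp.eLpNorm_ne_top _) hρT] at hw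
    exact absurd hw (not_lt.2 hle)
  obtain ⟨Λ, c, hΛ1, hΛ2⟩ := geometric_hahn_banach_open (convex_ball w₀ ρ.toReal)
    Metric.isOpen_ball hAconv hdisj
  have hc : c ≤ 0 := by simpa using hΛ2 0 h0A
  have hΛw₀ : Λ w₀ < 0 := (hΛ1 w₀ (Metric.mem_ball_self hρ0)).trans_le hc
  set G : Lp ℝ 2 ν := (InnerProductSpace.toDual ℝ (Lp ℝ 2 ν)).symm Λ with hG
  have hΛ : ∀ w : Lp ℝ 2 ν, Λ w = ∫ x, G x * w x ∂ν := by
    intro w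
    rw [← InnerProductSpace.toDual_symm_apply, L2.inner_def]
    simp [mul_comm, hG]
  have hGm : Measurable G := (Lp.stronglyMeasurable G).measurable
  -- The separating functional is negative at the positive constant M + 1, so its density G cannot
  -- be nonnegative almost everywhere.
  have hneg : ∃ n : ℕ, ν {x | G x < -(1 / (n + 1 : ℝ))} ≠ 0 := by
    by_contra! hall
    have hae : ∀ᵐ x ∂ν, 0 ≤ G x := by
      have : ∀ᵐ x ∂ν, ∀ n : ℕ, -(1 / (n + 1 : ℝ)) ≤ G x := by
        rw [ae_all_iff]
        intro n
        rw [ae_iff]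
        simpa using hall n
      filter_upwards [this] with x hx
      by_contra! h
      obtain ⟨n, hn⟩ := exists_nat_one_div_lt (neg_pos.2 h)
      linarith [hx n]
    rw [hΛ] at hΛw₀
    refine absurd hΛw₀ (not_lt.2 (integral_nonneg_of_ae ?_))
    filter_upwards [hae, hw₀x] with x h1 h2
    rw [h2]
    exact mul_nonneg h1 (by linarith)
  obtain ⟨n, hn⟩ := hneg
  set η : ℝ := 1 / (n + 1 : ℝ) with hη
  have hη0 : 0 < η := by positivity
  set E : Set X := {x | G x < -η} with hE
  have hEm : MeasurableSet E := measurableSet_lt hGm measurable_const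
  refine ⟨E, hEm, hn, ENNReal.ofReal (-c / η), ENNReal.ofReal_ne_top, fun u hu => ?_⟩
  rw [lintegral_eq_iSup_lintegral_min_natCast (hmeas u hu)]
  refine iSup_le fun m => ?_
  -- This truncation lies in `A`, hence c ≤ ∫ G v ≤ -η ∫ v, a bound independent of `u` and `m`.
  set v : X → ℝ := E.indicator fun x => (min (u x) m).toReal with hv
  have hminT : ∀ x, min (u x) (m : ℝ≥0∞) ≠ ∞ := fun x =>
    ne_top_of_le_ne_top (ENNReal.natCast_ne_top m) (min_le_right _ _)
  have hvm : Measurable v := (((hmeas u hu).min measurable_const).ennreal_toReal).indicator hEm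
  have hv0 : ∀ x, 0 ≤ v x := fun x => indicator_nonneg (fun _ _ => ENNReal.toReal_nonneg) x
  have hvb : ∀ x, ‖v x‖ ≤ m := by
    intro x
    rw [Real.norm_of_nonneg (hv0 x)]
    refine indicator_le' (fun x _ => ?_) (fun _ _ => Nat.cast_nonneg m) x
    exact ENNReal.toReal_le_of_le_ofReal (Nat.cast_nonneg m) (by simp)
  have hvL : MemLp v 2 ν := MemLp.of_bound hvm.aestronglyMeasurable m (ae_of_all _ hvb)
  have hvA : hvL.toLp v ∈ A := by
    refine ⟨u, hu, ?_⟩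
    filter_upwards [hvL.coeFn_toLp] with x hx
    rw [hx]
    by_cases hxE : x ∈ E
    · rw [hv, indicator_of_mem hxE, ENNReal.ofReal_toReal (hminT x)]
      exact min_le_left _ _
    · rw [hv, indicator_of_notMem hxE]
      simp
  have h1 : c ≤ ∫ x, G x * v x ∂ν := by
    refine (hΛ2 _ hvA).trans_eq ((hΛ _).trans (integral_congr_ae ?_))
    filter_upwards [hvL.coeFn_toLp] with x hx
    rw [hx]
  have hvint : Integrable v ν := hvL.integrable (by norm_num)
  have h2 : ∫ x, G x * v x ∂ν ≤ ∫ x, -η * v x ∂ν := by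
    refine integral_mono ((Lp.memLp G).integrable_mul hvL) (hvint.const_mul _) fun x => ?_
    change G x * v x ≤ -η * v x
    by_cases hxE : x ∈ E
    · exact mul_le_mul_of_nonneg_right (le_of_lt hxE) (hv0 x)
    · rw [hv, indicator_of_notMem hxE]
      simp
  rw [integral_const_mul] at h2
  have h3 : ∫ x, v x ∂ν ≤ -c / η := by
    rw [le_div_iff₀ hη0]
    linarith
  calc ∫⁻ x in E, min (u x) m ∂ν = ∫⁻ x, ENNReal.ofReal (v x) ∂ν := by
        rw [← lintegral_indicator hEm]
        refine lintegral_congr fun x => ?_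
        by_cases hxE : x ∈ E
        · rw [hv, indicator_of_mem hxE, indicator_of_mem hxE, ENNReal.ofReal_toReal (hminT x)]
        · rw [hv, indicator_of_notMem hxE, indicator_of_notMem hxE, ENNReal.ofReal_zero]
    _ = ENNReal.ofReal (∫ x, v x ∂ν) :=
        (ofReal_integral_eq_lintegral_ofReal hvint (ae_of_all _ hv0)).symm
    _ ≤ _ := ENNReal.ofReal_le_ofReal h3

end Factorization

/-! ### Bessel potentials, capacity and boundedness in measure -/

section Potential

variable {N : ℕ} {a s q : ℝ}

theorem measurable_besselKernel (a : ℝ) :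
    Measurable (besselKernel a : EuclideanSpace ℝ (Fin N) → ℝ≥0∞) := by
  unfold besselKernel
  refine Measurable.const_mul ?_ _
  refine Measurable.lintegral_prod_right' (f := fun z : EuclideanSpace ℝ (Fin N) × ℝ =>
    ENNReal.ofReal (z.2 ^ (a / 2 - 1) * Real.exp (-z.2) *
      (4 * Real.pi * z.2) ^ (-(N : ℝ) / 2) * Real.exp (-‖z.1‖ ^ 2 / (4 * z.2)))) ?_
  fun_prop

theorem measurable_besselPotential {f : EuclideanSpace ℝ (Fin N) → ℝ≥0∞} (hf : Measurable f) :
    Measurable (besselPotential a f) := by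
  unfold besselPotential
  refine Measurable.lintegral_prod_right'
    (f := fun z : EuclideanSpace ℝ (Fin N) × EuclideanSpace ℝ (Fin N) =>
      besselKernel a (z.1 - z.2) * f z.2) ?_
  exact ((measurable_besselKernel a).comp (measurable_fst.sub measurable_snd)).mul
    (hf.comp measurable_snd)

theorem besselPotential_tsum_mul {ι : Type*} [Countable ι] (θ : ι → ℝ≥0∞)
    {f : ι → EuclideanSpace ℝ (Fin N) → ℝ≥0∞} (hf : ∀ i, Measurable (f i))
    (x : EuclideanSpace ℝ (Fin N)) :
    besselPotential a (fun y => ∑' i, θ i * f i y) x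
      = ∑' i, θ i * besselPotential a (f i) x := by
  unfold besselPotential
  have hm : ∀ i, Measurable fun y => besselKernel a (x - y) * f i y := fun i =>
    ((measurable_besselKernel a).comp (measurable_const.sub measurable_id)).mul (hf i)
  simp_rw [← ENNReal.tsum_mul_left, mul_left_comm _ (θ _)]
  rw [lintegral_tsum fun i => ((hm i).const_mul _).aemeasurable]
  exact tsum_congr fun i => lintegral_const_mul _ (hm i)

theorem besselPotential_const_mul (c : ℝ≥0∞) {f : EuclideanSpace ℝ (Fin N) → ℝ≥0∞}
    (hf : Measurable f) (x : EuclideanSpace ℝ (Fin N)) :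
    besselPotential a (fun y => c * f y) x = c * besselPotential a f x := by
  simpa using besselPotential_tsum_mul (a := a) (fun _ : Unit => c) (fun _ => hf) x

theorem exists_lorentzBesselCapacity_le (hs : 1 < s) (hq : 1 ≤ q) :
    ∃ C : ℝ≥0∞, C ≠ ∞ ∧ ∀ (f : EuclideanSpace ℝ (Fin N) → ℝ≥0∞) (c : ℝ≥0∞)
      (A : Set (EuclideanSpace ℝ (Fin N))),
      f ∈ interpolationBall volume s q → (∀ x ∈ A, 1 ≤ c * besselPotential a f x) →
      lorentzBesselCapacity a s (ENNReal.ofReal q) A ≤ C * c := by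
  obtain ⟨C, hC, h⟩ :=
    exists_lorentzNorm_le_sequenceNorm (ν := (volume : Measure (EuclideanSpace ℝ (Fin N)))) hs
  refine ⟨C, hC, ?_⟩
  rintro f c A ⟨b, φ, hb, hf⟩ hA
  have hq' : 1 ≤ ENNReal.ofReal q := by simpa using hq
  have hcf := hf.const_mul c
  calc lorentzBesselCapacity a s (ENNReal.ofReal q) A
      ≤ lorentzNorm volume s (ENNReal.ofReal q) fun x => c * f x := by
        refine iInf_le_of_le _ (iInf_le_of_le hcf.measurable_sum (iInf_le_of_le ?_ le_rfl))
        intro x hx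
        rw [besselPotential_const_mul c hf.measurable_sum]
        exact hA x hx
    _ ≤ C * sequenceNorm (ENNReal.ofReal q) fun k => c * b k := h _ hq' _ _ _ hcf
    _ ≤ C * c := by
        rw [sequenceNorm_const_mul (one_pos.trans_le hq').ne']
        gcongr
        refine mul_le_of_le_one_right' ?_
        unfold sequenceNorm
        rw [if_neg ENNReal.ofReal_ne_top, ENNReal.toReal_ofReal (by linarith)]
        exact ENNReal.rpow_le_one hb (by positivity)

/-- Otherwise there are f_n in the ball with potentials huge on sets A_n of measure above ε. The
limsup of the A_n has measure at least ε, while ∑_i 2^{-(i+1)} f_{m+i} stays in the ball and shows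
that its capacity is O(2^{-m}) for every m. -/
theorem exists_measure_lt_besselPotential_le (hs : 1 < s) (hq : 1 ≤ q)
    {μ : Measure (EuclideanSpace ℝ (Fin N))} {E : Set (EuclideanSpace ℝ (Fin N))}
    (hE : MeasurableSet E) (hμE : μ E ≠ ∞)
    (hac : ∀ A ⊆ E, MeasurableSet A → lorentzBesselCapacity a s (ENNReal.ofReal q) A = 0 → μ A = 0)
    {ε : ℝ≥0∞} (hε : ε ≠ 0) :
    ∃ M : ℝ, 0 ≤ M ∧ ∀ f ∈ interpolationBall volume s q,
      μ (E ∩ {x | ENNReal.ofReal M < besselPotential a f x}) ≤ ε := by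
  by_contra! hcon
  -- With n = m + i, the factor 2^{n+1} absorbs the weight 2^{-(i+1)} and leaves 2^m; the factor 2^n
  -- makes the smallness 2^{-m} of the multiplier affordable.
  choose f hf hεf using fun n : ℕ => hcon ((2 : ℝ) ^ n * 2 ^ (n + 1)) (by positivity)
  have hof : ∀ n : ℕ, ENNReal.ofReal ((2 : ℝ) ^ n * 2 ^ (n + 1)) = 2 ^ n * 2 ^ (n + 1) := by
    intro n
    rw [ENNReal.ofReal_mul (by positivity), ENNReal.ofReal_pow zero_le_two,
      ENNReal.ofReal_pow zero_le_two]
    simp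
  simp_rw [hof] at hεf
  have hfm : ∀ n, Measurable (f n) := fun n => measurable_of_mem_interpolationBall (hf n)
  set A : ℕ → Set (EuclideanSpace ℝ (Fin N)) := fun n =>
    E ∩ {x | 2 ^ n * 2 ^ (n + 1) < besselPotential a (f n) x} with hA
  have hAm : ∀ n, MeasurableSet (A n) := fun n =>
    hE.inter (measurableSet_lt measurable_const (measurable_besselPotential (hfm n)))
  set B : ℕ → Set (EuclideanSpace ℝ (Fin N)) := fun m => ⋃ i, A (m + i) with hB
  have hBm : ∀ m, MeasurableSet (B m) := fun m => MeasurableSet.iUnion fun i => hAm _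
  have hBE : ∀ m, B m ⊆ E := fun m => iUnion_subset fun i => inter_subset_left
  have hBanti : Antitone B := by
    intro m n hmn x hx
    obtain ⟨i, hi⟩ := mem_iUnion.1 hx
    refine mem_iUnion.2 ⟨n - m + i, ?_⟩
    rwa [show m + (n - m + i) = n + i by omega]
  have hμB : ε ≤ μ (⋂ m, B m) := by
    rw [hBanti.measure_iInter (fun m => (hBm m).nullMeasurableSet)
      ⟨0, ne_top_of_le_ne_top hμE (measure_mono (hBE 0))⟩]
    refine le_iInf fun m => (hεf m).le.trans (measure_mono ?_)
    exact subset_iUnion_of_subset 0 (by simp [hA])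
  obtain ⟨C, hC, hcap⟩ := exists_lorentzBesselCapacity_le (N := N) (a := a) hs hq
  have hcapB : ∀ m : ℕ,
      lorentzBesselCapacity a s (ENNReal.ofReal q) (⋂ m, B m) ≤ C * 2⁻¹ ^ m := by
    intro m
    have hθ : ∑' i : ℕ, (2⁻¹ : ℝ≥0∞) ^ (i + 1) ≤ 1 := by
      simp_rw [pow_succ]
      rw [ENNReal.tsum_mul_right, ENNReal.tsum_geometric, ENNReal.one_sub_inv_two, inv_inv,
        ENNReal.mul_inv_cancel two_ne_zero ENNReal.ofNat_ne_top]
    refine hcap _ _ _ (tsum_mul_mem_interpolationBall hq hθ fun i => hf (m + i)) fun x hx => ?_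
    obtain ⟨i, -, hi⟩ := mem_iUnion.1 (mem_iInter.1 hx m)
    rw [besselPotential_tsum_mul _ fun i => hfm (m + i)]
    have h2 : ∀ n : ℕ, (2⁻¹ : ℝ≥0∞) ^ n * 2 ^ n = 1 := fun n => by
      rw [← mul_pow, ENNReal.inv_mul_cancel two_ne_zero ENNReal.ofNat_ne_top, one_pow]
    calc (1 : ℝ≥0∞) ≤ 2 ^ (m + i) := one_le_pow_of_one_le' (by norm_num) _
      _ = (2⁻¹ ^ m * 2 ^ m) * (2⁻¹ ^ (i + 1) * 2 ^ (i + 1)) * 2 ^ (m + i) := by simp [h2]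
      _ = 2⁻¹ ^ m * (2⁻¹ ^ (i + 1) * (2 ^ (m + i) * 2 ^ (m + i + 1))) := by ring
      _ ≤ 2⁻¹ ^ m * (2⁻¹ ^ (i + 1) * besselPotential a (f (m + i)) x) := by
          gcongr
          exact le_of_lt hi
      _ ≤ _ := by
          gcongr
          exact ENNReal.le_tsum (f := fun i => 2⁻¹ ^ (i + 1) * besselPotential a (f (m + i)) x) i
  have hzero : lorentzBesselCapacity a s (ENNReal.ofReal q) (⋂ m, B m) = 0 := by
    have hlim : Tendsto (fun m : ℕ => C * (2⁻¹ : ℝ≥0∞) ^ m) atTop (𝓝 (C * 0)) :=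
      ENNReal.Tendsto.const_mul
        (ENNReal.tendsto_pow_atTop_nhds_zero_of_lt_one ENNReal.one_half_lt_one)
        (Or.inr hC)
    rw [mul_zero] at hlim
    exact le_antisymm (ge_of_tendsto' hlim hcapB) bot_le
  have := hac _ ((iInter_subset B 0).trans (hBE 0)) (MeasurableSet.iInter hBm) hzero
  rw [this] at hμB
  exact hε (le_antisymm hμB bot_le)

theorem exists_subset_setLIntegral_besselPotential_le (hs : 1 < s) (hq : 1 ≤ q)
    {μ : Measure (EuclideanSpace ℝ (Fin N))} {E : Set (EuclideanSpace ℝ (Fin N))}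
    (hE : MeasurableSet E) (hμE : μ E ≠ ∞) (hμE0 : μ E ≠ 0)
    (hac : ∀ A ⊆ E, MeasurableSet A →
      lorentzBesselCapacity a s (ENNReal.ofReal q) A = 0 → μ A = 0) :
    ∃ E' ⊆ E, MeasurableSet E' ∧ μ E' ≠ 0 ∧ ∃ C ≠ ∞,
      ∀ f ∈ interpolationBall volume s q, ∫⁻ x in E', besselPotential a f x ∂μ ≤ C := by
  have hε : μ E / 2 ≠ 0 := by simpa using hμE0
  obtain ⟨M, hM0, hM⟩ := exists_measure_lt_besselPotential_le hs hq hE hμE hac hε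
  have : IsFiniteMeasure (μ.restrict E) := ⟨by simpa using hμE.lt_top⟩
  have hmeas : ∀ u ∈ besselPotential a '' interpolationBall
      (volume : Measure (EuclideanSpace ℝ (Fin N))) s q, Measurable u := by
    rintro _ ⟨f, hf, rfl⟩
    exact measurable_besselPotential (measurable_of_mem_interpolationBall hf)
  have hconv : ∀ u ∈ besselPotential a '' interpolationBall
      (volume : Measure (EuclideanSpace ℝ (Fin N))) s q,
      ∀ v ∈ besselPotential a '' interpolationBall volume s q, ∀ c d : ℝ≥0∞, c + d = 1 →
      (fun x => c * u x + d * v x) ∈ besselPotential a '' interpolationBall volume s q := by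
    rintro _ ⟨f, hf, rfl⟩ _ ⟨g, hg, rfl⟩ c d hcd
    have hfg : ∀ i : Bool, (bif i then f else g) ∈ interpolationBall volume s q := by
      rintro (_ | _) <;> assumption
    refine ⟨_, tsum_mul_mem_interpolationBall (θ := fun i => bif i then c else d) hq (by
      simp [hcd]) hfg, ?_⟩
    ext x
    rw [besselPotential_tsum_mul _ fun i => measurable_of_mem_interpolationBall (hfg i)]
    simp
  have hbdd : ∀ u ∈ besselPotential a '' interpolationBall
      (volume : Measure (EuclideanSpace ℝ (Fin N))) s q,
      μ.restrict E {x | ENNReal.ofReal M < u x} ≤ μ.restrict E univ / 2 := by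
    rintro _ ⟨f, hf, rfl⟩
    have hm : MeasurableSet {x | ENNReal.ofReal M < besselPotential a f x} :=
      measurableSet_lt measurable_const (hmeas _ (mem_image_of_mem _ hf))
    rw [Measure.restrict_apply hm, Measure.restrict_apply_univ, inter_comm]
    exact hM f hf
  obtain ⟨E', hE'm, hE'0, C, hC, h⟩ := exists_setLIntegral_le_of_bounded_in_measure
    (μ.restrict E) (by simpa using hμE0)
    (Set.Nonempty.image _ ⟨0, zero_mem_interpolationBall (by linarith)⟩) hmeas hconv hM0 hbdd
  refine ⟨E ∩ E', inter_subset_left, hE.inter hE'm, ?_, C, hC, fun f hf => ?_⟩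
  · rwa [Measure.restrict_apply hE'm, inter_comm] at hE'0
  · have := h _ (mem_image_of_mem _ hf)
    rwa [Measure.restrict_restrict hE'm, inter_comm] at this

end Potential

/-! ### Exhaustion by good sets -/

section Exhaustion

variable {X : Type*} [MeasurableSpace X] {μ : Measure X} {Good : Set X → Prop}

/-- Take good subsets of `K` whose measures tend to the supremum. A good piece of positive measure
in the remainder could be joined to each of them, exceeding that finite supremum. -/
theorem exists_countable_exhaustion {K : Set X} (hK : MeasurableSet K) (hμK : μ K ≠ ∞)
    (h0 : Good ∅) (hU : ∀ A B, Good A → Good B → Good (A ∪ B))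
    (hex : ∀ E ⊆ K, MeasurableSet E → μ E ≠ 0 → ∃ E' ⊆ E, MeasurableSet E' ∧ μ E' ≠ 0 ∧ Good E') :
    ∃ A : ℕ → Set X, (∀ n, MeasurableSet (A n)) ∧ (∀ n, Good (A n)) ∧ μ (K \ ⋃ n, A n) = 0 := by
  set S : Set ℝ≥0∞ := {r | ∃ A ⊆ K, MeasurableSet A ∧ Good A ∧ μ A = r} with hS
  have hne : S.Nonempty := ⟨_, ∅, empty_subset _, MeasurableSet.empty, h0, rfl⟩
  obtain ⟨r, -, hlim, hr⟩ := exists_seq_tendsto_sSup hne (OrderTop.bddAbove S)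
  choose A hAK hAm hAG hAr using hr
  refine ⟨A, hAm, hAG, ?_⟩
  by_contra hpos
  obtain ⟨E, hE, hEm, hE0, hEG⟩ := hex _ sdiff_subset (hK.diff (MeasurableSet.iUnion hAm)) hpos
  have hsT : sSup S ≠ ∞ := by
    refine ne_top_of_le_ne_top hμK (sSup_le ?_)
    rintro _ ⟨B, hB, -, -, rfl⟩
    exact measure_mono hB
  have hle : ∀ n, r n + μ E ≤ sSup S := by
    intro n
    have hd : Disjoint (A n) E :=
      Set.disjoint_left.2 fun x hx hxE => (hE hxE).2 (mem_iUnion.2 ⟨n, hx⟩)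
    rw [← hAr n, ← measure_union hd hEm]
    exact le_sSup ⟨_, union_subset (hAK n) (hE.trans sdiff_subset), (hAm n).union hEm,
      hU _ _ (hAG n) hEG, rfl⟩
  have := le_of_tendsto' (hlim.add_const (μ E)) hle
  exact hE0 (le_antisymm ((ENNReal.addLECancellable_iff_ne.2 hsT).add_le_iff_nonpos_right.1 this)
    bot_le)

theorem exists_monotone_exhaustion {K : ℕ → Set X} (hK : ∀ j, MeasurableSet (K j))
    (hμK : ∀ j, μ (K j) ≠ ∞) (h0 : Good ∅) (hU : ∀ A B, Good A → Good B → Good (A ∪ B))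
    (hex : ∀ j, ∀ E ⊆ K j, MeasurableSet E → μ E ≠ 0 →
      ∃ E' ⊆ E, MeasurableSet E' ∧ μ E' ≠ 0 ∧ Good E') :
    ∃ A : ℕ → Set X, Monotone A ∧ (∀ n, MeasurableSet (A n)) ∧ (∀ n, Good (A n)) ∧
      μ ((⋃ j, K j) \ ⋃ n, A n) = 0 := by
  choose A hAm hAG hA0 using fun j => exists_countable_exhaustion (hK j) (hμK j) h0 hU (hex j)
  set B : ℕ → Set X := fun n => A n.unpair.1 n.unpair.2 with hB
  refine ⟨Set.accumulate B, Set.monotone_accumulate, fun n => ?_, fun n => ?_, ?_⟩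
  · exact MeasurableSet.biUnion (to_countable _) fun i _ => hAm _ _
  · induction n with
    | zero => simpa using hAG _ _
    | succ n ih => rw [Set.accumulate_succ]; exact hU _ _ ih (hAG _ _)
  · rw [Set.iUnion_accumulate, iUnion_sdiff]
    refine measure_iUnion_null fun j => measure_mono_null ?_ (hA0 j)
    refine sdiff_subset_sdiff_right (iUnion_subset fun n => ?_)
    refine subset_iUnion_of_subset (Nat.pair j n) ?_
    simp [hB]

theorem tendsto_integral_restrict {A : ℕ → Set X} (hA : Monotone A)
    (hAm : ∀ n, MeasurableSet (A n)) (hfull : μ (⋃ n, A n)ᶜ = 0) {φ : X → ℝ}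
    (hφ : Integrable φ μ) :
    Tendsto (fun n => ∫ x in A n, φ x ∂μ) atTop (𝓝 (∫ x, φ x ∂μ)) := by
  have h := tendsto_setIntegral_of_monotone hAm hA (f := φ) hφ.integrableOn
  rwa [Measure.restrict_eq_self_of_ae_mem (s := ⋃ n, A n) (mem_ae_iff.2 hfull)] at h

end Exhaustion

/-! ### Weak and narrow convergence of restrictions -/

section Convergence

variable {N : ℕ} {Ω : Set (EuclideanSpace ℝ (Fin N))} {μ : Measure (EuclideanSpace ℝ (Fin N))}
  {A : ℕ → Set (EuclideanSpace ℝ (Fin N))}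

theorem tendstoWeakly_restrict (hμ : IsRadonIn Ω μ) (hA : Monotone A)
    (hAm : ∀ n, MeasurableSet (A n)) (hfull : μ (⋃ n, A n)ᶜ = 0) :
    TendstoWeakly Ω (fun n => μ.restrict (A n)) μ := by
  intro φ hφ hc hsub
  refine tendsto_integral_restrict hA hAm hfull ?_
  rw [← integrableOn_iff_integrable_of_support_subset (subset_tsupport φ)]
  exact hφ.continuousOn.integrableOn_of_subset_isCompact hc (isClosed_tsupport φ).measurableSet
    subset_rfl (hμ.2 _ hsub hc).ne

theorem tendstoNarrowly_restrict (hΩ : IsOpen Ω) (hfin : μ univ < ∞) (hA : Monotone A)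
    (hAm : ∀ n, MeasurableSet (A n)) (hfull : μ (⋃ n, A n)ᶜ = 0) :
    TendstoNarrowly Ω (fun n => μ.restrict (A n)) μ := by
  rintro φ hφ ⟨C, hC⟩
  have : IsFiniteMeasure μ := ⟨hfin⟩
  simp_rw [Measure.restrict_restrict hΩ.measurableSet, inter_comm Ω,
    ← Measure.restrict_restrict (hAm _)]
  refine tendsto_integral_restrict hA hAm (Measure.absolutelyContinuous_of_le
    Measure.restrict_le_self hfull) ?_
  refine Integrable.of_bound (hφ.aestronglyMeasurable hΩ.measurableSet) C ?_
  filter_upwards [ae_restrict_mem hΩ.measurableSet] with x hx using hC x hx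

end Convergence

/-! ### Comparison of the Bessel kernel with a dyadic Riesz kernel -/

section Kernel

variable {N : ℕ} {a L R : ℝ}

/-- The discrete truncated Riesz kernel `∑ₙ rₙ^{a-N} 1_{|z| < L rₙ}`, `rₙ = R 2^{-n}`. -/
noncomputable def dyadicKernel (a L R : ℝ) (z : EuclideanSpace ℝ (Fin N)) : ℝ≥0∞ :=
  ∑' n : ℕ, (Metric.ball (0 : EuclideanSpace ℝ (Fin N)) (L * (R / 2 ^ n))).indicator
    (fun _ => ENNReal.ofReal ((R / 2 ^ n) ^ (a - N))) z

/-- The discrete truncated Riesz potential `∑ₙ rₙ^{a-N} ν(B(x, L rₙ))`, `rₙ = R 2^{-n}`. -/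
noncomputable def dyadicPotential (a L R : ℝ) (ν : Measure (EuclideanSpace ℝ (Fin N)))
    (x : EuclideanSpace ℝ (Fin N)) : ℝ≥0∞ :=
  ∑' n : ℕ, ENNReal.ofReal ((R / 2 ^ n) ^ (a - N)) * ν (Metric.ball x (L * (R / 2 ^ n)))

theorem measurable_dyadicKernel :
    Measurable (dyadicKernel a L R : EuclideanSpace ℝ (Fin N) → ℝ≥0∞) :=
  Measurable.tsum fun _ => measurable_const.indicator Metric.isOpen_ball.measurableSet

theorem dyadicPotential_eq_lintegral (ν : Measure (EuclideanSpace ℝ (Fin N)))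
    (y : EuclideanSpace ℝ (Fin N)) :
    dyadicPotential a L R ν y = ∫⁻ x, dyadicKernel a L R (x - y) ∂ν := by
  unfold dyadicPotential dyadicKernel
  have hm : ∀ n : ℕ, Measurable fun x : EuclideanSpace ℝ (Fin N) =>
      (Metric.ball (0 : EuclideanSpace ℝ (Fin N)) (L * (R / 2 ^ n))).indicator
        (fun _ => ENNReal.ofReal ((R / 2 ^ n) ^ (a - N))) (x - y) := fun n =>
    (measurable_const.indicator Metric.isOpen_ball.measurableSet).comp
      (measurable_id.sub measurable_const)
  rw [lintegral_tsum fun n => (hm n).aemeasurable]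
  refine tsum_congr fun n => ?_
  rw [← lintegral_indicator_const Metric.isOpen_ball.measurableSet]
  refine lintegral_congr fun x => ?_
  simp only [indicator, Metric.mem_ball, dist_eq_norm, sub_zero]

theorem measurable_dyadicPotential (ν : Measure (EuclideanSpace ℝ (Fin N))) [SFinite ν] :
    Measurable (dyadicPotential a L R ν) := by
  rw [funext (dyadicPotential_eq_lintegral ν)]
  exact Measurable.lintegral_prod_left'
    (f := fun z : EuclideanSpace ℝ (Fin N) × EuclideanSpace ℝ (Fin N) =>
      dyadicKernel a L R (z.1 - z.2))
    (measurable_dyadicKernel.comp (measurable_fst.sub measurable_snd))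

/-- In the heat kernel formula, times t in (r²/4, r²] with r = R 2^{-n} account for the n-th term:
for |z| < L r the integrand is at least a constant times r^{a-N-2}, on an interval of length 3r²/4.
These intervals are disjoint. -/
theorem exists_mul_dyadicKernel_le_besselKernel (ha : 0 < a) (haN : a < N) (hR : 0 < R)
    (hL : 0 < L) :
    ∃ c : ℝ≥0∞, c ≠ 0 ∧ ∀ z : EuclideanSpace ℝ (Fin N),
      c * dyadicKernel a L R z ≤ besselKernel a z := by
  have hπ := Real.pi_pos
  -- The factors bound e^{-t} for t ≤ R² and e^{-|z|²/(4t)} for |z| < L r, r² ≤ 4t; 3/4 comes from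
  -- the length of the interval.
  set c₀ : ℝ := (4 * Real.pi) ^ (-(N : ℝ) / 2) * Real.exp (-R ^ 2) * Real.exp (-L ^ 2) * (3 / 4)
    with hc₀
  have hc₀pos : 0 < c₀ := by positivity
  have hΓ : 0 < (Real.Gamma (a / 2))⁻¹ := inv_pos.2 (Real.Gamma_pos_of_pos (by positivity))
  refine ⟨ENNReal.ofReal (Real.Gamma (a / 2))⁻¹ * ENNReal.ofReal c₀, ?_, fun z => ?_⟩
  · exact mul_ne_zero (by simpa using hΓ) (by simpa using hc₀pos)
  unfold besselKernel dyadicKernel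
  rw [mul_assoc]
  gcongr
  set I : ℕ → Set ℝ := fun n => Ioc ((R / 2 ^ (n + 1)) ^ 2) ((R / 2 ^ n) ^ 2) with hI
  have hanti : Antitone fun n : ℕ => (R / 2 ^ n) ^ 2 := by
    intro m n hmn
    simp only
    gcongr
    norm_num
  have hdisj : Pairwise (Function.onFun Disjoint I) := by
    have := hanti.pairwise_disjoint_on_Ioc_succ
    simpa [hI] using this
  have hsub : (⋃ n, I n) ⊆ Ioi 0 := by
    refine iUnion_subset fun n t ht => ?_
    exact lt_of_le_of_lt (by positivity) ht.1
  refine le_trans ?_ (lintegral_mono_set hsub)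
  rw [lintegral_iUnion (fun n => measurableSet_Ioc) hdisj, ← ENNReal.tsum_mul_left]
  refine ENNReal.tsum_le_tsum fun n => ?_
  by_cases hz : z ∈ Metric.ball (0 : EuclideanSpace ℝ (Fin N)) (L * (R / 2 ^ n))
  swap
  · rw [indicator_of_notMem hz, mul_zero]
    exact bot_le
  rw [indicator_of_mem hz, ← ENNReal.ofReal_mul hc₀pos.le]
  rw [mem_ball_zero_iff] at hz
  set r : ℝ := R / 2 ^ n with hr
  have hr0 : 0 < r := by positivity
  have hrR : r ≤ R := div_le_self hR.le (one_le_pow₀ one_le_two)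
  have hI' : I n = Ioc ((r / 2) ^ 2) (r ^ 2) := by
    simp only [hI, hr]
    congr 2
    rw [pow_succ, div_div]
  have hpt : ∀ t ∈ I n, ENNReal.ofReal ((4 * Real.pi) ^ (-(N : ℝ) / 2) * Real.exp (-R ^ 2) *
      Real.exp (-L ^ 2) * r ^ (a - N - 2)) ≤ ENNReal.ofReal
      (t ^ (a / 2 - 1) * Real.exp (-t) * (4 * Real.pi * t) ^ (-(N : ℝ) / 2) *
        Real.exp (-‖z‖ ^ 2 / (4 * t))) := by
    intro t ht
    rw [hI'] at ht
    have ht0 : 0 < t := lt_of_le_of_lt (by positivity) ht.1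
    apply ENNReal.ofReal_le_ofReal
    have h1 : r ^ (a - N - 2) ≤ t ^ (a / 2 - 1) * t ^ (-(N : ℝ) / 2) := by
      rw [← Real.rpow_add ht0]
      have h2 : r ^ (a - N - 2) = (r ^ 2) ^ (a / 2 - 1 + -(N : ℝ) / 2) := by
        rw [← Real.rpow_natCast r 2, ← Real.rpow_mul hr0.le]
        congr 1
        push_cast
        ring
      rw [h2]
      exact Real.rpow_le_rpow_of_nonpos ht0 ht.2 (by linarith)
    have h3 : Real.exp (-R ^ 2) ≤ Real.exp (-t) := by
      apply Real.exp_le_exp.2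
      have : r ^ 2 ≤ R ^ 2 := by gcongr
      linarith [ht.2]
    have h4 : Real.exp (-L ^ 2) ≤ Real.exp (-‖z‖ ^ 2 / (4 * t)) := by
      apply Real.exp_le_exp.2
      rw [neg_div, neg_le_neg_iff, div_le_iff₀ (by positivity)]
      have h5 : ‖z‖ ^ 2 ≤ (L * r) ^ 2 := by gcongr
      have h6 : r ^ 2 ≤ 4 * t := by nlinarith [ht.1]
      calc ‖z‖ ^ 2 ≤ L ^ 2 * r ^ 2 := by rw [← mul_pow]; exact h5
        _ ≤ L ^ 2 * (4 * t) := by gcongr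
    rw [Real.mul_rpow (by positivity) ht0.le]
    calc (4 * Real.pi) ^ (-(N : ℝ) / 2) * Real.exp (-R ^ 2) * Real.exp (-L ^ 2) * r ^ (a - N - 2)
        ≤ (4 * Real.pi) ^ (-(N : ℝ) / 2) * Real.exp (-t) * Real.exp (-‖z‖ ^ 2 / (4 * t)) *
          (t ^ (a / 2 - 1) * t ^ (-(N : ℝ) / 2)) := by gcongr
      _ = _ := by ring
  refine le_trans (le_of_eq ?_) (setLIntegral_mono' measurableSet_Ioc hpt)
  rw [setLIntegral_const, show Ioc ((R / 2 ^ (n + 1)) ^ 2) (r ^ 2)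
    = Ioc ((r / 2) ^ 2) (r ^ 2) from hI',
    Real.volume_Ioc, ← ENNReal.ofReal_mul (by positivity)]
  congr 1
  have h7 : r ^ (a - N) = r ^ (a - N - 2) * r ^ 2 := by
    rw [← Real.rpow_natCast r 2, ← Real.rpow_add hr0]
    congr 1
    push_cast
    ring
  rw [h7, hc₀]
  ring

/-- By Tonelli, the potential operator moves from `f` to `ν`. -/
theorem lintegral_mul_dyadicPotential_le {c : ℝ≥0∞}
    (hc : ∀ z : EuclideanSpace ℝ (Fin N), c * dyadicKernel a L R z ≤ besselKernel a z)
    (ν : Measure (EuclideanSpace ℝ (Fin N))) [SFinite ν]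
    {f : EuclideanSpace ℝ (Fin N) → ℝ≥0∞} (hf : Measurable f) :
    c * ∫⁻ y, f y * dyadicPotential a L R ν y ≤ ∫⁻ x, besselPotential a f x ∂ν := by
  have hk : Measurable fun z : EuclideanSpace ℝ (Fin N) × EuclideanSpace ℝ (Fin N) =>
      c * dyadicKernel a L R (z.2 - z.1) * f z.1 :=
    ((measurable_dyadicKernel.comp (measurable_snd.sub measurable_fst)).const_mul c).mul
      (hf.comp measurable_fst)
  calc c * ∫⁻ y, f y * dyadicPotential a L R ν y
      = ∫⁻ y, (∫⁻ x, c * dyadicKernel a L R (x - y) * f y ∂ν) := by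
        rw [← lintegral_const_mul _ (show Measurable fun y => f y * dyadicPotential a L R ν y from
          hf.mul (measurable_dyadicPotential ν))]
        refine lintegral_congr fun y => ?_
        have hm : Measurable fun x : EuclideanSpace ℝ (Fin N) => dyadicKernel a L R (x - y) :=
          measurable_dyadicKernel.comp (measurable_id.sub measurable_const)
        rw [lintegral_mul_const _ (hm.const_mul c), lintegral_const_mul _ hm,
          ← dyadicPotential_eq_lintegral]
        ring
    _ = ∫⁻ x, (∫⁻ y, c * dyadicKernel a L R (x - y) * f y) ∂ν :=
        lintegral_lintegral_swap hk.aemeasurable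
    _ ≤ _ := by
        refine lintegral_mono fun x => lintegral_mono fun y => ?_
        gcongr
        exact hc _

end Kernel

/-! ### A good-λ inequality for adapted sums -/

section GoodLambda

variable {X : Type*} {mX : MeasurableSpace X} {ν : Measure X}

/-- A good-`λ` inequality in rearrangement form, for a sum of nonnegative functions adapted to a
filtration. -/
theorem rearrangement_tsum_le_add {ℱ : ℕ → MeasurableSpace X} (hmono : Monotone ℱ)
    (hle : ∀ n, ℱ n ≤ mX) {g : ℕ → X → ℝ≥0∞} (hg : ∀ n, Measurable[ℱ n] (g n)) {A : ℝ≥0∞}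
    (hloc : ∀ n B, MeasurableSet[ℱ n] B →
      ∫⁻ x in B, ∑' j, g (n + j) x ∂ν ≤ A * ∫⁻ x in B, g n x ∂ν)
    {M : X → ℝ≥0∞} (hM : ∀ n x, g n x ≤ M x) {t : ℝ} (ht : 0 < t) :
    rearrangement ν (fun x => ∑' n, g n x) t
      ≤ rearrangement ν (fun x => ∑' n, g n x) (2 * t) + 4 * (A * rearrangement ν M (t / 2)) := by
  set F : X → ℝ≥0∞ := fun x => ∑' n, g n x with hF
  set ℓ := rearrangement ν F (2 * t) with hℓ
  set m := rearrangement ν M (t / 2) with hm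
  rcases eq_or_ne (A * m) ∞ with hT | hT
  · rw [hT]; simp
  set S : ℕ → X → ℝ≥0∞ := fun n x => ∑ j ∈ Finset.range n, g j x with hS
  set T : ℕ → X → ℝ≥0∞ := fun n x => ∑' j, g (n + j) x with hTdef
  have hST : ∀ n x, F x = S n x + T n x := by
    intro n x
    simp only [hF, hS, hTdef, add_comm n]
    exact (ENNReal.summable.sum_add_tsum_nat_add' (f := fun j => g j x)).symm
  have hSmono : ∀ x, Monotone fun n => S n x := fun x m n hmn =>
    Finset.sum_le_sum_of_subset (Finset.range_mono hmn)
  have hgm : ∀ j n, j ≤ n → Measurable[ℱ n] (g j) := fun j n hjn =>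
    (hg j).mono (hmono hjn) le_rfl
  have hgm' : ∀ j, Measurable (g j) := fun j => (hg j).mono (hle j) le_rfl
  have hTm : ∀ n, Measurable (T n) := fun n => Measurable.tsum fun j => hgm' _
  have hSm : ∀ n k, k ≤ n + 1 → Measurable[ℱ n] (S k) := fun n k hk =>
    Finset.measurable_fun_sum _ fun j hj => hgm j n (by have := Finset.mem_range.1 hj; omega)
  -- Stopping sets: adding `g n` first pushes the partial sum above ℓ. Since `S n` omits `g n` and
  -- `T n` includes it, F ≤ ℓ + `T n` on `O n`, with no separate jump term.
  set O : ℕ → Set X := fun n => {x | S n x ≤ ℓ} ∩ {x | ℓ < S (n + 1) x} with hO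
  have hOm : ∀ n, MeasurableSet[ℱ n] (O n) := by
    intro n
    exact @MeasurableSet.inter _ (ℱ n) _ _ (hSm n n n.le_succ measurableSet_Iic)
      (hSm n (n + 1) le_rfl measurableSet_Ioi)
  have hOdisj : Pairwise (Function.onFun Disjoint O) := by
    rw [pairwise_disjoint_on]
    intro i j hij
    refine Set.disjoint_left.2 fun x hx hx' => ?_
    exact absurd (hx.2.trans_le ((hSmono x (Nat.succ_le_of_lt hij)).trans hx'.1)) (lt_irrefl _)
  have hOsum : ∑' n, ν (O n) ≤ ENNReal.ofReal (2 * t) := by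
    rw [← measure_iUnion hOdisj fun n => hle n _ (hOm n)]
    refine le_trans (measure_mono (iUnion_subset fun n x hx => ?_))
      (measure_rearrangement_lt_le ν F (2 * t))
    have h1 : ℓ < S (n + 1) x := hx.2
    have h2 : S (n + 1) x ≤ F x := by rw [hST (n + 1) x]; exact le_self_add
    exact h1.trans_le h2
  set B : ℕ → Set X := fun n => O n ∩ {x | g n x ≤ m} with hB
  have hBm : ∀ n, MeasurableSet[ℱ n] (B n) := fun n =>
    @MeasurableSet.inter _ (ℱ n) _ _ (hOm n)
      (hg n measurableSet_Iic)
  -- Chebyshev for the tail. The sets `O n` have total mass at most 2t, so this costs t/2, as does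
  -- {M > m}; together they give t.
  have hBle : ∀ n, ν (B n ∩ {x | 4 * (A * m) < T n x}) ≤ ν (O n) / 4 := by
    intro n
    have hint : ∫⁻ x in B n, T n x ∂ν ≤ A * m * ν (O n) := by
      refine (hloc n _ (hBm n)).trans ?_
      rw [mul_assoc]
      gcongr
      calc ∫⁻ x in B n, g n x ∂ν ≤ ∫⁻ x in B n, m ∂ν :=
            setLIntegral_mono' (hle n _ (hBm n)) fun x hx => hx.2
        _ = m * ν (B n) := setLIntegral_const _ _
        _ ≤ m * ν (O n) := by gcongr; exact inter_subset_left
    have hms : MeasurableSet {x | 4 * (A * m) < T n x} :=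
      measurableSet_lt measurable_const (hTm n)
    rw [inter_comm, ← Measure.restrict_apply hms]
    rcases eq_or_ne (A * m) 0 with h0 | h0
    · rw [h0, zero_mul] at hint
      have hae := (lintegral_eq_zero_iff (hTm n)).1 (le_antisymm hint bot_le)
      refine le_trans (le_of_eq ?_) bot_le
      rw [h0, mul_zero]
      have : ∀ᵐ x ∂(ν.restrict (B n)), ¬ (0 < T n x) := by
        filter_upwards [hae] with x hx
        rw [hx]
        simp
      exact measure_eq_zero_iff_ae_notMem.2 this
    · have h40 : 4 * (A * m) ≠ 0 := mul_ne_zero (by norm_num) h0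
      have h4T : 4 * (A * m) ≠ ∞ := ENNReal.mul_ne_top (by norm_num) hT
      calc ν.restrict (B n) {x | 4 * (A * m) < T n x}
          ≤ ν.restrict (B n) {x | 4 * (A * m) ≤ T n x} :=
            measure_mono fun x (hx : 4 * (A * m) < T n x) => hx.le
        _ ≤ (∫⁻ x in B n, T n x ∂ν) / (4 * (A * m)) :=
            meas_ge_le_lintegral_div (hTm n).aemeasurable h40 h4T
        _ ≤ (A * m * ν (O n)) / (A * m * 4) := by
            rw [mul_comm 4]
            gcongr
        _ = ν (O n) / 4 := ENNReal.mul_div_mul_left _ _ h0 hT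
  refine rearrangement_le ?_
  have hcover : {x | ℓ + 4 * (A * m) < F x}
      ⊆ {x | m < M x} ∪ ⋃ n, B n ∩ {x | 4 * (A * m) < T n x} := by
    intro x hx
    rw [mem_union, or_iff_not_imp_left]
    intro hxM
    have hxM' : M x ≤ m := not_lt.1 hxM
    have hex : ∃ n, ℓ < S n x := by
      by_contra! hall
      have : F x ≤ ℓ := ENNReal.tsum_le_of_sum_range_le hall
      exact absurd (le_self_add.trans_lt hx) (not_lt.2 this)
    classical
    obtain ⟨n, hn⟩ : ∃ n, Nat.find hex = n + 1 := by
      refine Nat.exists_eq_succ_of_ne_zero fun h0 => ?_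
      have := Nat.find_spec hex
      rw [h0] at this
      simp [hS] at this
    have h1 : ℓ < S (n + 1) x := hn ▸ Nat.find_spec hex
    have h2 : S n x ≤ ℓ := not_lt.1 (Nat.find_min hex (by omega))
    refine mem_iUnion.2 ⟨n, ⟨⟨h2, h1⟩, (hM n x).trans hxM'⟩, ?_⟩
    by_contra! h3
    have h4 : F x ≤ ℓ + 4 * (A * m) := by
      rw [hST n x]
      exact add_le_add h2 (not_lt.1 h3)
    exact absurd hx (not_lt.2 h4)
  calc ν {x | ℓ + 4 * (A * m) < F x}
      ≤ ν {x | m < M x} + ∑' n, ν (B n ∩ {x | 4 * (A * m) < T n x}) :=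
        (measure_mono hcover).trans ((measure_union_le _ _).trans
          (by gcongr; exact measure_iUnion_le _))
    _ ≤ ENNReal.ofReal (t / 2) + ∑' n, ν (O n) / 4 :=
        add_le_add (measure_rearrangement_lt_le ν M _) (ENNReal.tsum_le_tsum hBle)
    _ ≤ ENNReal.ofReal (t / 2) + ENNReal.ofReal (2 * t) / 4 := by
        gcongr
        simp_rw [div_eq_mul_inv]
        rw [ENNReal.tsum_mul_right]
        gcongr
    _ = ENNReal.ofReal t := by
        rw [show (4 : ℝ≥0∞) = ENNReal.ofReal 4 by simp,
          ← ENNReal.ofReal_div_of_pos (by norm_num), ← ENNReal.ofReal_add (by positivity)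
          (by positivity)]
        congr 1
        ring

theorem rearrangement_eq_zero {F : X → ℝ≥0∞} {t : ℝ} (h : ν {x | F x ≠ 0} ≤ ENNReal.ofReal t) :
    rearrangement ν F t = 0 := by
  refine le_antisymm (rearrangement_le (le_trans (measure_mono fun x hx => ?_) h)) bot_le
  exact (ne_of_gt hx)

/-- Iterates the good-λ inequality along t, 2t, 4t, ...; the leading term vanishes once 2^J t
exceeds the measure of the support. -/
theorem rearrangement_tsum_le {ℱ : ℕ → MeasurableSpace X} (hmono : Monotone ℱ)
    (hle : ∀ n, ℱ n ≤ mX) {g : ℕ → X → ℝ≥0∞} (hg : ∀ n, Measurable[ℱ n] (g n)) {A : ℝ≥0∞}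
    (hloc : ∀ n B, MeasurableSet[ℱ n] B →
      ∫⁻ x in B, ∑' j, g (n + j) x ∂ν ≤ A * ∫⁻ x in B, g n x ∂ν)
    {M : X → ℝ≥0∞} (hM : ∀ n x, g n x ≤ M x) (hsupp : ν {x | ∑' n, g n x ≠ 0} ≠ ∞)
    {t : ℝ} (ht : 0 < t) :
    rearrangement ν (fun x => ∑' n, g n x) t
      ≤ ∑' j : ℕ, 4 * (A * rearrangement ν M (2 ^ j * t / 2)) := by
  have hiter : ∀ J : ℕ, rearrangement ν (fun x => ∑' n, g n x) t
      ≤ rearrangement ν (fun x => ∑' n, g n x) (2 ^ J * t)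
        + ∑ j ∈ Finset.range J, 4 * (A * rearrangement ν M (2 ^ j * t / 2)) := by
    intro J
    induction J with
    | zero => simp
    | succ J ih =>
      refine ih.trans ?_
      rw [Finset.sum_range_succ, add_comm (Finset.sum _ _), ← add_assoc]
      gcongr
      have := rearrangement_tsum_le_add hmono hle hg hloc hM (t := 2 ^ J * t) (by positivity)
      rwa [pow_succ', mul_assoc]
  obtain ⟨J, hJ⟩ : ∃ J : ℕ, (ν {x | ∑' n, g n x ≠ 0}).toReal / t < 2 ^ J :=
    pow_unbounded_of_one_lt _ one_lt_two
  have hJ' : ν {x | ∑' n, g n x ≠ 0} ≤ ENNReal.ofReal (2 ^ J * t) := by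
    rw [← ENNReal.ofReal_toReal hsupp]
    apply ENNReal.ofReal_le_ofReal
    rw [div_lt_iff₀ ht] at hJ
    exact hJ.le
  refine (hiter J).trans ?_
  rw [rearrangement_eq_zero hJ', zero_add]
  exact ENNReal.sum_le_tsum _

end GoodLambda

/-! ### Dyadic cubes -/

section Grid

variable {N : ℕ} {r : ℝ}

/-- The index of the cube of side `r` containing `x`. -/
noncomputable def cubeIndex (r : ℝ) (x : EuclideanSpace ℝ (Fin N)) : Fin N → ℤ := fun i => ⌊x i / r⌋

/-- The corner of the cube of side `r` with index `z`. -/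
noncomputable def cubeCorner (r : ℝ) (z : Fin N → ℤ) : EuclideanSpace ℝ (Fin N) :=
  WithLp.toLp 2 fun i => r * z i

theorem measurable_cubeIndex : Measurable (cubeIndex r : EuclideanSpace ℝ (Fin N) → Fin N → ℤ) := by
  refine measurable_pi_lambda _ fun i => Int.measurable_floor.comp ?_
  fun_prop

theorem cubeIndex_two_mul (x : EuclideanSpace ℝ (Fin N)) :
    cubeIndex (2 * r) x = fun i => cubeIndex r x i / 2 := by
  ext i
  unfold cubeIndex
  rw [mul_comm, ← div_div]
  exact_mod_cast Int.floor_div_natCast (x i / r) 2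

theorem dist_cubeCorner_le (hr : 0 < r) (x : EuclideanSpace ℝ (Fin N)) :
    dist x (cubeCorner r (cubeIndex r x)) ≤ N * r := by
  rw [EuclideanSpace.dist_eq]
  refine Real.sqrt_le_iff.2 ⟨by positivity, ?_⟩
  have h : ∀ i, dist (x i) (cubeCorner r (cubeIndex r x) i) ^ 2 ≤ r ^ 2 := by
    intro i
    have h1 : dist (x i) (cubeCorner r (cubeIndex r x) i) ≤ r := by
      rw [Real.dist_eq]
      change |x i - r * (⌊x i / r⌋ : ℤ)| ≤ r
      have h2 := Int.floor_le (x i / r)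
      have h3 := Int.lt_floor_add_one (x i / r)
      rw [le_div_iff₀ hr] at h2
      rw [div_lt_iff₀ hr] at h3
      rw [abs_le]
      constructor <;> nlinarith
    gcongr
  calc ∑ i, dist (x i) (cubeCorner r (cubeIndex r x) i) ^ 2 ≤ ∑ _i : Fin N, r ^ 2 :=
        Finset.sum_le_sum fun i _ => h i
    _ = N * r ^ 2 := by simp
    _ ≤ (N * r) ^ 2 := by
        rw [mul_pow]
        gcongr
        exact_mod_cast Nat.le_self_pow two_ne_zero N

theorem volume_cubeIndex_preimage (hr : 0 < r) (z : Fin N → ℤ) :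
    volume (cubeIndex r ⁻¹' {z} : Set (EuclideanSpace ℝ (Fin N))) = ENNReal.ofReal r ^ N := by
  have h : (cubeIndex r ⁻¹' {z} : Set (EuclideanSpace ℝ (Fin N)))
      = WithLp.ofLp ⁻¹' (Set.pi univ fun i => Ico (r * z i) (r * (z i + 1))) := by
    ext x
    simp only [mem_preimage, mem_singleton_iff, mem_univ_pi, mem_Ico, funext_iff, cubeIndex]
    refine forall_congr' fun i => ?_
    rw [Int.floor_eq_iff, le_div_iff₀ hr, div_lt_iff₀ hr, mul_comm r, mul_comm r]
  rw [h, (PiLp.volume_preserving_ofLp (Fin N)).measure_preimage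
    (MeasurableSet.univ_pi fun i => measurableSet_Ico).nullMeasurableSet, volume_pi_pi]
  simp only [Real.volume_Ico, mul_add, mul_one, add_sub_cancel_left]
  simp

end Grid

/-! ### Discrete Wolff potentials and their tails on cubes -/

section Averages

variable {N : ℕ} {a γ R : ℝ} {ν : Measure (EuclideanSpace ℝ (Fin N))}

theorem setLIntegral_rpow_le {X : Type*} [MeasurableSpace X] {ν : Measure X} {f : X → ℝ≥0∞}
    (hf : Measurable f) (hγ : 0 < γ) (hγ1 : γ < 1) (Q : Set X) :
    ∫⁻ x in Q, f x ^ γ ∂ν ≤ (∫⁻ x in Q, f x ∂ν) ^ γ * ν Q ^ (1 - γ) := by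
  have hc : (1 / γ).HolderConjugate (1 / (1 - γ)) := by
    refine Real.holderConjugate_iff.2 ⟨by rw [lt_div_iff₀ hγ]; linarith, ?_⟩
    simp
  have := ENNReal.lintegral_mul_le_Lp_mul_Lq (ν.restrict Q) hc
    (f := fun x => f x ^ γ) (g := fun _ => 1) (hf.pow_const γ).aemeasurable aemeasurable_const
  simpa [← ENNReal.rpow_mul, hγ.ne'] using this

/-- The discrete Wolff term at scale `r`, constant on the cubes of side `r`. -/
noncomputable def cubeDensity (a γ r : ℝ) (ν : Measure (EuclideanSpace ℝ (Fin N)))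
    (x : EuclideanSpace ℝ (Fin N)) : ℝ≥0∞ :=
  (ENNReal.ofReal (r ^ (a - N)) *
    ν (Metric.ball (cubeCorner r (cubeIndex r x)) (4 * N * r))) ^ γ

theorem measurable_cubeDensity_comap (a γ r : ℝ) (ν : Measure (EuclideanSpace ℝ (Fin N))) :
    Measurable[MeasurableSpace.comap (cubeIndex r) inferInstance] (cubeDensity a γ r ν) := by
  have : cubeDensity a γ r ν = (fun z => (ENNReal.ofReal (r ^ (a - N)) *
    ν (Metric.ball (cubeCorner r z) (4 * N * r))) ^ γ) ∘ cubeIndex r := rfl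
  rw [this]
  exact (measurable_of_countable _).comp (comap_measurable _)

theorem measurable_cubeDensity (a γ r : ℝ) (ν : Measure (EuclideanSpace ℝ (Fin N))) :
    Measurable (cubeDensity a γ r ν) :=
  (measurable_cubeDensity_comap a γ r ν).mono measurable_cubeIndex.comap_le le_rfl

theorem cubeDensity_le {r : ℝ} (hr : 0 < r) (hγ : 0 < γ) (x : EuclideanSpace ℝ (Fin N)) :
    cubeDensity a γ r ν x
      ≤ (ENNReal.ofReal (r ^ (a - N)) * ν (Metric.ball x (5 * N * r))) ^ γ := by
  unfold cubeDensity
  gcongr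
  refine Metric.ball_subset_ball' ?_
  rw [dist_comm]
  linarith [dist_cubeCorner_le hr x]

theorem le_cubeDensity (hN : 0 < N) {r : ℝ} (hr : 0 < r) (hγ : 0 < γ)
    (x : EuclideanSpace ℝ (Fin N)) :
    (ENNReal.ofReal (r ^ (a - N)) * ν (Metric.ball x r)) ^ γ ≤ cubeDensity a γ r ν x := by
  unfold cubeDensity
  have hN' : (1 : ℝ) ≤ N := by exact_mod_cast hN
  gcongr
  refine Metric.ball_subset_ball' ?_
  nlinarith [dist_cubeCorner_le hr x]

theorem setLIntegral_measure_ball_le [SFinite ν] {ρ : ℝ} {x₀ : EuclideanSpace ℝ (Fin N)}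
    {d : ℝ} (hρ : 0 < ρ) {Q : Set (EuclideanSpace ℝ (Fin N))}
    (hQm : MeasurableSet Q) (hQ : ∀ x ∈ Q, dist x x₀ ≤ d) :
    ∫⁻ x in Q, ν (Metric.ball x ρ)
      ≤ ENNReal.ofReal (ρ ^ N) * volume (Metric.ball (0 : EuclideanSpace ℝ (Fin N)) 1)
        * ν (Metric.ball x₀ (d + ρ)) := by
  have hm : MeasurableSet {z : EuclideanSpace ℝ (Fin N) × EuclideanSpace ℝ (Fin N) |
      dist z.2 z.1 < ρ} := measurableSet_lt (by fun_prop) measurable_const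
  calc ∫⁻ x in Q, ν (Metric.ball x ρ)
      = ∫⁻ x in Q, (∫⁻ y, {z : EuclideanSpace ℝ (Fin N) × EuclideanSpace ℝ (Fin N) |
          dist z.2 z.1 < ρ}.indicator 1 (x, y) ∂ν) := by
        refine lintegral_congr fun x => ?_
        exact (lintegral_indicator_one (s := Metric.ball x ρ)
          Metric.isOpen_ball.measurableSet).symm
    _ = ∫⁻ y, (∫⁻ x in Q, {z : EuclideanSpace ℝ (Fin N) × EuclideanSpace ℝ (Fin N) |
          dist z.2 z.1 < ρ}.indicator 1 (x, y)) ∂ν :=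
        lintegral_lintegral_swap (measurable_one.indicator hm).aemeasurable
    _ ≤ ∫⁻ y, (Metric.ball x₀ (d + ρ)).indicator (fun _ => ENNReal.ofReal (ρ ^ N) *
          volume (Metric.ball (0 : EuclideanSpace ℝ (Fin N)) 1)) y ∂ν := by
        refine lintegral_mono fun y => ?_
        by_cases hy : y ∈ Metric.ball x₀ (d + ρ)
        · rw [indicator_of_mem hy]
          calc _ ≤ ∫⁻ x, (Metric.ball y ρ).indicator 1 x := by
                refine (setLIntegral_le_lintegral _ _).trans (lintegral_mono fun x => ?_)
                simp only [indicator, mem_ofPred_eq, Metric.mem_ball, dist_comm x y]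
                exact le_rfl
            _ = volume (Metric.ball y ρ) :=
                lintegral_indicator_one Metric.isOpen_ball.measurableSet
            _ = _ := by
                rw [Measure.addHaar_ball_of_pos _ _ hρ]
                simp
        · rw [indicator_of_notMem hy]
          refine le_of_eq ((setLIntegral_congr_fun (g := fun _ => 0) hQm fun x hx => ?_).trans
            lintegral_zero)
          refine indicator_of_notMem (fun h => hy ?_) _
          have h' : dist y x < ρ := h
          rw [Metric.mem_ball]
          linarith [dist_triangle y x x₀, hQ x hx]
    _ = _ := lintegral_indicator_const Metric.isOpen_ball.measurableSet _

/-- On a cube of side `r`, the density at the finer scale `r 2^{-j}` is on average at most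
`C 2^{-jaγ}` times the density at scale `r`. -/
theorem exists_setLIntegral_cubeDensity_le [SFinite ν] (hN : 0 < N) (hγ : 0 < γ) (hγ1 : γ < 1) :
    ∃ C : ℝ≥0∞, C ≠ ∞ ∧ ∀ r : ℝ, 0 < r → ∀ (z : Fin N → ℤ) (j : ℕ),
      ∫⁻ x in cubeIndex r ⁻¹' {z}, cubeDensity a γ (r / 2 ^ j) ν x
        ≤ C * 2 ^ (j * (-(a * γ))) * ∫⁻ x in cubeIndex r ⁻¹' {z}, cubeDensity a γ r ν x := by
  have hN' : (1 : ℝ) ≤ N := by exact_mod_cast hN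
  set ω := volume (Metric.ball (0 : EuclideanSpace ℝ (Fin N)) 1) with hω
  have hωT : ω ≠ ∞ := measure_ball_lt_top.ne
  set C₀ : ℝ≥0∞ := ENNReal.ofReal ((5 * N) ^ N) * ω with hC₀
  have hC₀T : C₀ ≠ ∞ := ENNReal.mul_ne_top ENNReal.ofReal_ne_top hωT
  refine ⟨1 + C₀ ^ γ, ENNReal.add_ne_top.2
    ⟨ENNReal.one_ne_top, ENNReal.rpow_ne_top_of_nonneg hγ.le hC₀T⟩, fun r hr z j => ?_⟩
  rcases j.eq_zero_or_pos with rfl | hj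
  · simp only [pow_zero, div_one, Nat.cast_zero, zero_mul, ENNReal.rpow_zero, mul_one]
    exact le_mul_of_one_le_left' le_self_add
  set Q : Set (EuclideanSpace ℝ (Fin N)) := cubeIndex r ⁻¹' {z} with hQ
  have hQm : MeasurableSet Q := measurable_cubeIndex (measurableSet_singleton z)
  set ρ : ℝ := r / 2 ^ j with hρ
  have hρ0 : 0 < ρ := by positivity
  have hρr : ρ ≤ r / 2 := by
    rw [hρ]
    gcongr
    exact le_self_pow₀ one_le_two hj.ne'
  set m := ν (Metric.ball (cubeCorner r z) (4 * N * r)) with hm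
  have hQd : ∀ x ∈ Q, dist x (cubeCorner r z) ≤ N * r := by
    intro x hx
    rw [← show cubeIndex r x = z from hx]
    exact dist_cubeCorner_le hr x
  have hconst : ∫⁻ x in Q, cubeDensity a γ r ν x
      = (ENNReal.ofReal (r ^ (a - N)) * m) ^ γ * ENNReal.ofReal r ^ N := by
    rw [← volume_cubeIndex_preimage hr z, ← setLIntegral_const]
    refine setLIntegral_congr_fun hQm fun x hx => ?_
    unfold cubeDensity
    rw [show cubeIndex r x = z from hx]
  -- All balls involved lie within N r + 5Nρ ≤ 4N r of the corner because ρ ≤ r/2; this is why the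
  -- scale j = 0 is treated apart. Averaging in x replaces ρ^{a-N} by ρ^a, and Hölder with γ < 1
  -- then gives the gain 2^{-jaγ}.
  have hball : ∫⁻ x in Q, ENNReal.ofReal (ρ ^ (a - N)) * ν (Metric.ball x (5 * N * ρ))
      ≤ C₀ * ENNReal.ofReal (ρ ^ a) * m := by
    have h1 := setLIntegral_measure_ball_le (ν := ν) (ρ := 5 * N * ρ) (by positivity) hQm hQd
    rw [lintegral_const_mul' _ _ ENNReal.ofReal_ne_top]
    calc _ ≤ ENNReal.ofReal (ρ ^ (a - N)) * (ENNReal.ofReal ((5 * N * ρ) ^ N) * ω *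
          ν (Metric.ball (cubeCorner r z) (N * r + 5 * N * ρ))) := by gcongr
      _ ≤ ENNReal.ofReal (ρ ^ (a - N)) * (ENNReal.ofReal ((5 * N * ρ) ^ N) * ω * m) := by
          gcongr
          exact measure_mono (Metric.ball_subset_ball (by nlinarith))
      _ = C₀ * ENNReal.ofReal (ρ ^ a) * m := by
          have h2 : ρ ^ a = ρ ^ (a - N) * ρ ^ N := by
            rw [← Real.rpow_natCast ρ N, ← Real.rpow_add hρ0, sub_add_cancel]
          rw [h2, mul_pow, ENNReal.ofReal_mul (by positivity), ENNReal.ofReal_mul (by positivity),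
            hC₀]
          ring
  have hmeasf : Measurable fun x : EuclideanSpace ℝ (Fin N) =>
      ENNReal.ofReal (ρ ^ (a - N)) * ν (Metric.ball x (5 * N * ρ)) := by
    refine Measurable.const_mul ?_ _
    have hms : MeasurableSet {z : EuclideanSpace ℝ (Fin N) × EuclideanSpace ℝ (Fin N) |
      dist z.2 z.1 < 5 * N * ρ} := measurableSet_lt (by fun_prop) measurable_const
    exact measurable_measure_prodMk_left hms
  calc ∫⁻ x in Q, cubeDensity a γ ρ ν x
      ≤ ∫⁻ x in Q, (ENNReal.ofReal (ρ ^ (a - N)) * ν (Metric.ball x (5 * N * ρ))) ^ γ :=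
        lintegral_mono fun x => cubeDensity_le hρ0 hγ x
    _ ≤ (C₀ * ENNReal.ofReal (ρ ^ a) * m) ^ γ * (ENNReal.ofReal r ^ N) ^ (1 - γ) := by
        refine (setLIntegral_rpow_le hmeasf hγ hγ1 Q).trans ?_
        rw [hQ, volume_cubeIndex_preimage hr z]
        gcongr
    _ = C₀ ^ γ * 2 ^ (j * (-(a * γ))) *
          ((ENNReal.ofReal (r ^ (a - N)) * m) ^ γ * ENNReal.ofReal r ^ N) := by
        have hr' : ENNReal.ofReal r ≠ 0 := by simpa using hr
        have e1 : ENNReal.ofReal (ρ ^ a) ^ γ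
            = ENNReal.ofReal r ^ (a * γ) * 2 ^ (j * (-(a * γ))) := by
          rw [← ENNReal.ofReal_rpow_of_pos hρ0, ← ENNReal.rpow_mul, hρ,
            ENNReal.ofReal_div_of_pos (by positivity), ENNReal.ofReal_pow zero_le_two,
            div_eq_mul_inv, ENNReal.mul_rpow_of_ne_top ENNReal.ofReal_ne_top (by simp)]
          congr 1
          rw [ENNReal.inv_rpow, ← ENNReal.rpow_neg, ← ENNReal.rpow_natCast, ← ENNReal.rpow_mul]
          simp
        have e2 : ENNReal.ofReal (r ^ (a - N)) ^ γ = ENNReal.ofReal r ^ ((a - N) * γ) := by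
          rw [← ENNReal.ofReal_rpow_of_pos hr, ← ENNReal.rpow_mul]
        rw [ENNReal.mul_rpow_of_nonneg _ m hγ.le, ENNReal.mul_rpow_of_nonneg C₀ _ hγ.le,
          ENNReal.mul_rpow_of_nonneg _ m hγ.le, e1, e2, ← ENNReal.rpow_natCast,
          ← ENNReal.rpow_mul]
        have e3 : ENNReal.ofReal r ^ (a * γ) * ENNReal.ofReal r ^ ((N : ℝ) * (1 - γ))
            = ENNReal.ofReal r ^ ((a - N) * γ) * ENNReal.ofReal r ^ (N : ℝ) := by
          rw [← ENNReal.rpow_add _ _ hr' ENNReal.ofReal_ne_top,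
            ← ENNReal.rpow_add _ _ hr' ENNReal.ofReal_ne_top]
          congr 1
          ring
        calc _ = C₀ ^ γ * 2 ^ (j * (-(a * γ))) * m ^ γ *
              (ENNReal.ofReal r ^ (a * γ) * ENNReal.ofReal r ^ ((N : ℝ) * (1 - γ))) := by ring
          _ = _ := by rw [e3]; ring
    _ ≤ _ := by
        rw [hconst]
        gcongr
        exact le_add_self

/-- The discrete Wolff potential. -/
noncomputable def cubeWolffPotential (a γ R : ℝ) (ν : Measure (EuclideanSpace ℝ (Fin N)))
    (x : EuclideanSpace ℝ (Fin N)) : ℝ≥0∞ :=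
  ∑' n : ℕ, cubeDensity a γ (R / 2 ^ n) ν x

theorem comap_cubeIndex_le {r : ℝ} :
    MeasurableSpace.comap (cubeIndex (N := N) (2 * r)) inferInstance
      ≤ MeasurableSpace.comap (cubeIndex (N := N) r) inferInstance := by
  have : cubeIndex (N := N) (2 * r) = (fun z i => z i / 2) ∘ cubeIndex r := by
    ext1 x
    exact cubeIndex_two_mul x
  rw [this, ← MeasurableSpace.comap_comp]
  exact MeasurableSpace.comap_mono (measurable_of_countable _).comap_le

/-- The good-λ lemma applies with the σ-algebras of the grids: summing 2^{-jaγ} gives the tail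
hypothesis, P^γ dominates each term, and bounded support of `ν` makes the support of the sum finite.
-/
theorem exists_rearrangement_cubeWolffPotential_le [SFinite ν] (hN : 0 < N) (ha : 0 < a)
    (hγ : 0 < γ) (hγ1 : γ < 1) (hR : 0 < R) {K : Set (EuclideanSpace ℝ (Fin N))}
    (hK : Bornology.IsBounded K) (hνK : ν Kᶜ = 0) :
    ∃ A : ℝ≥0∞, A ≠ ∞ ∧ ∀ t : ℝ, 0 < t →
      rearrangement volume (cubeWolffPotential a γ R ν) t
        ≤ ∑' j : ℕ, A * rearrangement volume (dyadicPotential a (5 * N) R ν) (2 ^ j * t / 2) ^ γ := by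
  obtain ⟨C, hC, hloc⟩ := exists_setLIntegral_cubeDensity_le (ν := ν) (a := a) hN hγ hγ1
  set A : ℝ≥0∞ := C * ∑' j : ℕ, 2 ^ (j * (-(a * γ))) with hA
  have hAT : A ≠ ∞ := ENNReal.mul_ne_top hC
    (tsum_rpow_natCast_mul_ne_top (neg_neg_of_pos (mul_pos ha hγ)))
  refine ⟨4 * A, ENNReal.mul_ne_top (by norm_num) hAT, fun t ht => ?_⟩
  set ℱ : ℕ → MeasurableSpace (EuclideanSpace ℝ (Fin N)) := fun n =>
    MeasurableSpace.comap (cubeIndex (R / 2 ^ n)) inferInstance with hℱ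
  have hmono : Monotone ℱ := by
    refine monotone_nat_of_le_succ fun n => ?_
    have h := comap_cubeIndex_le (N := N) (r := R / 2 ^ (n + 1))
    rwa [show 2 * (R / 2 ^ (n + 1)) = R / 2 ^ n by rw [pow_succ]; field_simp] at h
  have hlocB : ∀ n B, MeasurableSet[ℱ n] B →
      ∫⁻ x in B, ∑' j, cubeDensity a γ (R / 2 ^ (n + j)) ν x
        ≤ A * ∫⁻ x in B, cubeDensity a γ (R / 2 ^ n) ν x := by
    rintro n _ ⟨S, -, rfl⟩
    have hS : cubeIndex (N := N) (R / 2 ^ n) ⁻¹' S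
        = ⋃ z : S, cubeIndex (R / 2 ^ n) ⁻¹' {(z : Fin N → ℤ)} := by
      rw [← preimage_iUnion, iUnion_of_singleton_coe]
    have hdisj : Pairwise (Function.onFun Disjoint fun z : S =>
        cubeIndex (N := N) (R / 2 ^ n) ⁻¹' {(z : Fin N → ℤ)}) := by
      intro z w hzw
      refine Disjoint.preimage _ (disjoint_singleton.2 fun h => hzw (Subtype.ext h))
    have hm : ∀ z : S, MeasurableSet (cubeIndex (N := N) (R / 2 ^ n) ⁻¹' {(z : Fin N → ℤ)}) :=
      fun z => measurable_cubeIndex (measurableSet_singleton _)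
    rw [hS, lintegral_iUnion hm hdisj, lintegral_iUnion hm hdisj, ← ENNReal.tsum_mul_left]
    refine ENNReal.tsum_le_tsum fun z => ?_
    rw [lintegral_tsum fun j => (measurable_cubeDensity _ _ _ _).aemeasurable, hA,
      ← ENNReal.tsum_mul_left, ← ENNReal.tsum_mul_right]
    refine ENNReal.tsum_le_tsum fun j => ?_
    have := hloc (R / 2 ^ n) (by positivity) z j
    rwa [div_div, ← pow_add] at this
  have hterm : ∀ n x, cubeDensity a γ (R / 2 ^ n) ν x ≤ dyadicPotential a (5 * N) R ν x ^ γ := by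
    intro n x
    refine (cubeDensity_le (by positivity) hγ x).trans ?_
    gcongr
    exact ENNReal.le_tsum (f := fun n : ℕ => ENNReal.ofReal ((R / 2 ^ n) ^ (a - N)) *
      ν (Metric.ball x (5 * N * (R / 2 ^ n)))) n
  have hsupp : volume {x | ∑' n : ℕ, cubeDensity a γ (R / 2 ^ n) ν x ≠ 0} ≠ ∞ := by
    obtain ⟨ρ, hρ⟩ := hK.subset_ball (0 : EuclideanSpace ℝ (Fin N))
    refine ne_top_of_le_ne_top (measure_ball_lt_top (x := 0) (r := ρ + 5 * N * R)).ne
      (measure_mono fun x hx => ?_)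
    by_contra hx'
    refine hx (ENNReal.tsum_eq_zero.2 fun n => ?_)
    refine le_antisymm ((cubeDensity_le (by positivity) hγ x).trans ?_) bot_le
    have hz : ν (Metric.ball x (5 * N * (R / 2 ^ n))) = 0 := by
      refine measure_mono_null (fun y hy => ?_) hνK
      intro hyK
      have h1 := hρ hyK
      rw [Metric.mem_ball] at hy h1 hx'
      have h2 : R / 2 ^ n ≤ R := div_le_self hR.le (one_le_pow₀ one_le_two)
      have h3 : 5 * N * (R / 2 ^ n) ≤ 5 * N * R := by gcongr
      have h4 := dist_triangle x y 0
      rw [dist_comm x y] at h4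
      linarith
    rw [hz, mul_zero, ENNReal.zero_rpow_of_pos hγ]
  refine (rearrangement_tsum_le hmono (fun n => measurable_cubeIndex.comap_le)
    (fun n => measurable_cubeDensity_comap a γ _ ν) hlocB hterm hsupp ht).trans ?_
  refine ENNReal.tsum_le_tsum fun j => ?_
  rw [← mul_assoc]
  gcongr
  exact rearrangement_le_of_monotone (ENNReal.monotone_rpow_of_nonneg hγ.le) fun x => le_rfl

theorem tsum_rpow_le_rpow_tsum {ι : Type*} (x : ι → ℝ≥0∞) (hγ : 1 ≤ γ) :
    ∑' i, x i ^ γ ≤ (∑' i, x i) ^ γ := by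
  have h : ∀ y : ℝ≥0∞, y ^ γ = y * y ^ (γ - 1) := fun y => by
    nth_rw 2 [← ENNReal.rpow_one y]
    rw [← ENNReal.rpow_add_of_nonneg _ _ zero_le_one (sub_nonneg.2 hγ)]
    simp
  simp_rw [h]
  rw [← ENNReal.tsum_mul_right]
  refine ENNReal.tsum_le_tsum fun i => ?_
  gcongr
  exact ENNReal.le_tsum i

theorem cubeWolffPotential_le_rpow (hγ : 1 ≤ γ) (hR : 0 < R) (x : EuclideanSpace ℝ (Fin N)) :
    cubeWolffPotential a γ R ν x ≤ dyadicPotential a (5 * N) R ν x ^ γ :=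
  (ENNReal.tsum_le_tsum fun _ => cubeDensity_le (by positivity) (by linarith) x).trans
    (tsum_rpow_le_rpow_tsum _ hγ)

end Averages

/-! ### Discretization of the Wolff potential -/

section Wolff

variable {N : ℕ} {α p R : ℝ}

theorem measurable_wolffPotential (ν : Measure (EuclideanSpace ℝ (Fin N))) [SFinite ν] :
    Measurable (wolffPotential α p R ν) := by
  have h : Measurable fun z : EuclideanSpace ℝ (Fin N) × ℝ => ν (Metric.ball z.1 z.2) := by
    have hms : MeasurableSet {w : (EuclideanSpace ℝ (Fin N) × ℝ) × EuclideanSpace ℝ (Fin N) |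
      dist w.2 w.1.1 < w.1.2} := measurableSet_lt (by fun_prop) (by fun_prop)
    exact measurable_measure_prodMk_left hms
  unfold wolffPotential
  refine Measurable.lintegral_prod_right' (f := fun z : EuclideanSpace ℝ (Fin N) × ℝ =>
    (ν (Metric.ball z.1 z.2) / ENNReal.ofReal (z.2 ^ ((N : ℝ) - α * p))) ^ (1 / (p - 1)) /
      ENNReal.ofReal z.2) ?_
  exact ((h.div (by fun_prop)).pow_const _).div (by fun_prop)

theorem wolffPotential_le (hp : 1 < p) (hN : 0 < N) (hαN : α * p < N) (hR : 0 < R)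
    (ν : Measure (EuclideanSpace ℝ (Fin N))) (x : EuclideanSpace ℝ (Fin N)) :
    wolffPotential α p R ν x
      ≤ 2 ^ ((N - α * p) * (1 / (p - 1))) * cubeWolffPotential (α * p) (1 / (p - 1)) R ν x := by
  have hγ : 0 < 1 / (p - 1) := by have : 0 < p - 1 := by linarith
                                  positivity
  set γ := 1 / (p - 1) with hγdef
  set a := α * p with ha
  have hcov : Ioo 0 R ⊆ ⋃ n : ℕ, Ioc (R / 2 ^ (n + 1)) (R / 2 ^ n) := by
    intro t ht
    obtain ⟨n, hn1, hn2⟩ := exists_nat_pow_near_of_lt_one (x := t / R) (y := 2⁻¹)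
      (div_pos ht.1 hR) ((div_le_one hR).2 ht.2.le) (by norm_num) (by norm_num)
    refine mem_iUnion.2 ⟨n, ?_, ?_⟩
    · rw [lt_div_iff₀ hR, inv_pow] at hn1
      rwa [div_eq_inv_mul]
    · rw [div_le_iff₀ hR, inv_pow] at hn2
      rwa [div_eq_inv_mul]
  unfold wolffPotential cubeWolffPotential
  refine (lintegral_mono_set hcov).trans ((lintegral_iUnion_le _ _).trans ?_)
  rw [← ENNReal.tsum_mul_left]
  refine ENNReal.tsum_le_tsum fun n => ?_
  set r : ℝ := R / 2 ^ n with hr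
  have hr0 : 0 < r := by positivity
  have hr2 : R / 2 ^ (n + 1) = r / 2 := by rw [hr, pow_succ, div_div]
  rw [hr2]
  have hr2' : ENNReal.ofReal (r / 2) ≠ 0 := by simpa using hr0
  have hpt : ∀ t ∈ Ioc (r / 2) r, (ν (Metric.ball x t) / ENNReal.ofReal (t ^ ((N : ℝ) - a))) ^ γ /
      ENNReal.ofReal t ≤ (2 ^ ((N - a) * γ) * cubeDensity a γ r ν x) / ENNReal.ofReal (r / 2) := by
    intro t ht
    have ht0 : 0 < t := lt_trans (by positivity) ht.1
    gcongr
    · calc (ν (Metric.ball x t) / ENNReal.ofReal (t ^ ((N : ℝ) - a))) ^ γ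
          ≤ (2 ^ (N - a) * (ENNReal.ofReal (r ^ (a - N)) * ν (Metric.ball x r))) ^ γ := by
            gcongr
            rw [div_eq_mul_inv, mul_comm, ← mul_assoc]
            gcongr
            · rw [← ENNReal.ofReal_inv_of_pos (by positivity), ← Real.rpow_neg ht0.le, neg_sub]
              calc ENNReal.ofReal (t ^ (a - N)) ≤ ENNReal.ofReal ((r / 2) ^ (a - N)) := by
                    apply ENNReal.ofReal_le_ofReal
                    exact Real.rpow_le_rpow_of_nonpos (by positivity) ht.1.le (by linarith)
                _ = _ := by
                    rw [Real.div_rpow hr0.le zero_le_two, div_eq_mul_inv,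
                      ← Real.rpow_neg zero_le_two, neg_sub, mul_comm,
                      ENNReal.ofReal_mul (by positivity), ← ENNReal.ofReal_rpow_of_pos two_pos]
                    simp
            · exact ht.2
        _ ≤ _ := by
            rw [ENNReal.mul_rpow_of_nonneg _ _ hγ.le, ← ENNReal.rpow_mul]
            gcongr
            exact le_cubeDensity hN hr0 hγ x
    · exact ht.1.le
  refine (setLIntegral_mono' measurableSet_Ioc hpt).trans (le_of_eq ?_)
  rw [setLIntegral_const, Real.volume_Ioc, show r - r / 2 = r / 2 by ring,
    ENNReal.div_mul_cancel hr2' ENNReal.ofReal_ne_top]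

end Wolff

/-! ### Lorentz norms from dyadic values of the rearrangement -/

section LorentzEstimate

theorem two_rpow_lt_top (x : ℝ) : (2 : ℝ≥0∞) ^ x < ∞ :=
  (by simp : (2 : ℝ≥0∞) ^ x ≠ ∞).lt_top

theorem sequenceNorm_rpow_lt_top {q σ : ℝ≥0∞} {γ : ℝ} (hγ : 0 < γ) (hσ : σ = ∞ ↔ q = ∞)
    (hq : 0 < q) (hqσ : σ.toReal = γ * q.toReal) {x : ℤ → ℝ≥0∞} (hx : sequenceNorm σ x < ∞) :
    sequenceNorm q (fun k => x k ^ γ) < ∞ := by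
  unfold sequenceNorm at hx ⊢
  by_cases h : q = ∞
  · rw [if_pos (hσ.2 h)] at hx
    rw [if_pos h]
    refine lt_of_le_of_lt (iSup_le fun k => ?_) (ENNReal.rpow_lt_top_of_nonneg hγ.le hx.ne)
    exact ENNReal.rpow_le_rpow (le_iSup x k) hγ.le
  · rw [if_neg (mt hσ.1 h)] at hx
    rw [if_neg h]
    have hq0 : 0 < q.toReal := ENNReal.toReal_pos hq.ne' h
    simp_rw [← ENNReal.rpow_mul, ← hqσ]
    refine ENNReal.rpow_lt_top_of_nonneg (by positivity) fun hT => ?_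
    rw [hT, ENNReal.top_rpow_of_pos (by rw [hqσ]; positivity)] at hx
    exact lt_irrefl _ hx

/-- When the norm uses f**, its dyadic values are averages ∑ 2^{-i} f*(2^{k-i}); the kernel
2^{-i(1-1/s)} is summable since s > 1. -/
theorem lorentzNorm_lt_top_of_sequenceNorm {X : Type*} [MeasurableSpace X] {ν : Measure X} {s : ℝ}
    {q : ℝ≥0∞} (hs : 0 < s) (hq : q ≠ 0) {f : X → ℝ≥0∞}
    (h : sequenceNorm q (fun k : ℤ => 2 ^ (k / s) * rearrangement ν f (2 ^ k)) < ∞) :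
    lorentzNorm ν s q f < ∞ := by
  unfold lorentzNorm
  split_ifs with hsq
  · refine (eLpNorm_haarHalfLine_le hs hq fun k t ht =>
      maximalRearrangement_le_tsum k ht).trans_lt ?_
    refine ENNReal.mul_lt_top (two_rpow_lt_top _) ?_
    have hs1 : 0 < 1 - 1 / s := by rw [sub_pos, div_lt_one hs]; exact hsq.1
    have hκ := tsum_rpow_natCast_mul_ne_top (neg_neg_of_pos hs1)
    refine lt_of_le_of_lt (sequenceNorm_mono fun k => le_of_eq ?_)
      ((sequenceNorm_convolution_le hsq.2 (fun n : ℕ => (2 : ℝ≥0∞) ^ (n * (-(1 - 1 / s))))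
        (fun n : ℕ => -(n : ℤ)) _).trans_lt (ENNReal.mul_lt_top hκ.lt_top h))
    rw [← ENNReal.tsum_mul_left]
    refine tsum_congr fun n => ?_
    have e : (2⁻¹ : ℝ≥0∞) ^ n = 2 ^ (-(n : ℝ)) := by
      rw [ENNReal.rpow_neg, ENNReal.rpow_natCast, ENNReal.inv_pow]
    rw [e, ← mul_assoc, ← mul_assoc, ← ENNReal.rpow_add _ _ two_ne_zero ENNReal.ofNat_ne_top,
      ← ENNReal.rpow_add _ _ two_ne_zero ENNReal.ofNat_ne_top, ← sub_eq_add_neg]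
    congr 2
    push_cast
    ring
  · refine (eLpNorm_haarHalfLine_le hs hq fun k t ht =>
      rearrangement_antitone ν f ht.1).trans_lt ?_
    exact ENNReal.mul_lt_top (two_rpow_lt_top _) h

end LorentzEstimate

/-! ### The Wolff potential of a good restriction -/

section Main

variable {N : ℕ} {α p s₁ R : ℝ} {s₂ : ℝ≥0∞}

theorem one_le_toReal_capacityExponent (hp : 1 < p) (hs₂ : ENNReal.ofReal (p - 1) < s₂) :
    1 ≤ (capacityExponent p s₂).toReal ∧
      ENNReal.ofReal (capacityExponent p s₂).toReal = capacityExponent p s₂ := by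
  unfold capacityExponent
  split_ifs with h
  · simp
  · have h1 : p - 1 < s₂.toReal :=
      (ENNReal.ofReal_lt_iff_lt_toReal (by linarith) h).1 hs₂
    refine ⟨?_, ENNReal.ofReal_toReal ENNReal.ofReal_ne_top⟩
    rw [ENNReal.toReal_ofReal (div_nonneg (by linarith) (by linarith)),
      le_div_iff₀ (by linarith)]
    linarith

theorem memLorentz_wolffPotential (hp : 1 < p) (hα : 0 < α * p) (hαN : α * p < N)
    (hs₁ : p - 1 < s₁) (hs₂ : ENNReal.ofReal (p - 1) < s₂) (hR : 0 < R)
    (ν : Measure (EuclideanSpace ℝ (Fin N))) [IsFiniteMeasure ν]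
    {K : Set (EuclideanSpace ℝ (Fin N))} (hK : Bornology.IsBounded K) (hνK : ν Kᶜ = 0)
    {C : ℝ≥0∞} (hC : C ≠ ∞)
    (hν : ∀ f ∈ interpolationBall volume (s₁ / (s₁ - p + 1)) (capacityExponent p s₂).toReal,
      ∫⁻ x, besselPotential (α * p) f x ∂ν ≤ C) :
    MemLorentz volume s₁ s₂ (wolffPotential α p R ν) := by
  refine ⟨(measurable_wolffPotential ν).aemeasurable, ?_⟩
  have hp0 : 0 < p - 1 := by linarith
  have hs₁0 : 0 < s₁ := hp0.trans hs₁
  have hs₂0 : 0 < s₂ := bot_le.trans_lt hs₂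
  have hN0 : 0 < N := by exact_mod_cast hα.trans hαN
  have hN1 : (1 : ℝ) ≤ N := by exact_mod_cast hN0
  set γ := 1 / (p - 1) with hγdef
  have hγ : 0 < γ := by positivity
  have hγp : γ * (p - 1) = 1 := one_div_mul_cancel hp0.ne'
  set P := dyadicPotential (α * p) (5 * N) R ν with hP
  have hPm : Measurable P := measurable_dyadicPotential ν
  -- The exponent conjugate to q; moreover 1 - 1/s = (p-1)/s₁, so the γ-th power turns the dual
  -- weights into 2^{k/s₁}.
  set σ : ℝ≥0∞ := if s₂ = ∞ then ∞ else ENNReal.ofReal (s₂.toReal / (p - 1)) with hσ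
  have hx : sequenceNorm σ (fun k : ℤ =>
      2 ^ (k * (1 - 1 / (s₁ / (s₁ - p + 1)))) * rearrangement volume P (2 ^ k)) < ∞ := by
    obtain ⟨c, hc0, hc⟩ := exists_mul_dyadicKernel_le_besselKernel (N := N) (L := 5 * N) hα hαN hR
      (by positivity)
    refine sequenceNorm_rearrangement_lt_top hPm (C := C / c) (ENNReal.div_ne_top hC hc0)
      (q := (capacityExponent p s₂).toReal) ?_
      (by linarith [(one_le_toReal_capacityExponent hp hs₂).1]) ?_
    · intro f hf
      rw [ENNReal.le_div_iff_mul_le (Or.inl hc0) (Or.inr hC), mul_comm]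
      exact (lintegral_mul_dyadicPotential_le hc ν
        (measurable_of_mem_interpolationBall hf)).trans (hν f hf)
    · rw [hσ]
      unfold capacityExponent
      split_ifs with h
      · exact Or.inl rfl
      · right
        have h1 : p - 1 < s₂.toReal := (ENNReal.ofReal_lt_iff_lt_toReal hp0.le h).1 hs₂
        have h2 : 0 < s₂.toReal - p + 1 := by linarith
        have h3 : 0 < s₂.toReal := hp0.trans h1
        refine ⟨_, ?_, rfl⟩
        rw [ENNReal.toReal_ofReal (by positivity)]
        refine Real.holderConjugate_iff.2 ⟨?_, ?_⟩
        · rw [lt_div_iff₀ h2]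
          linarith
        · rw [inv_div, inv_div, ← add_div, div_eq_one_iff_eq h3.ne']
          ring
  set z : ℤ → ℝ≥0∞ := fun k => 2 ^ (k / s₁) * rearrangement volume P (2 ^ k) ^ γ with hz
  have hzT : sequenceNorm s₂ z < ∞ := by
    have h := sequenceNorm_rpow_lt_top (q := s₂) hγ (by rw [hσ]; split_ifs <;> simp_all) hs₂0 (by
      rw [hσ]
      split_ifs with h
      · simp [h]
      · rw [ENNReal.toReal_ofReal (by positivity), hγdef]
        ring) hx
    refine lt_of_le_of_lt (sequenceNorm_mono fun k => le_of_eq ?_) h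
    simp only [hz]
    rw [ENNReal.mul_rpow_of_nonneg _ _ hγ.le, ← ENNReal.rpow_mul]
    congr 2
    have h1 : 1 - 1 / (s₁ / (s₁ - p + 1)) = (p - 1) / s₁ := by
      rw [one_div_div, eq_div_iff hs₁0.ne', sub_mul, div_mul_cancel₀ _ hs₁0.ne']
      ring
    rw [h1, mul_assoc, div_mul_eq_mul_div, mul_comm (p - 1), hγp, mul_one_div]
  set F := cubeWolffPotential (α * p) γ R ν with hF
  have hFT : sequenceNorm s₂ (fun k : ℤ => 2 ^ (k / s₁) * rearrangement volume F (2 ^ k)) < ∞ := by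
    rcases le_or_gt 1 γ with h1 | h1
    · refine lt_of_le_of_lt (sequenceNorm_mono fun k => ?_) hzT
      simp only [hz]
      gcongr
      exact rearrangement_le_of_monotone (ENNReal.monotone_rpow_of_nonneg hγ.le)
        fun x => cubeWolffPotential_le_rpow h1 hR x
    -- Here p > 2, so s₂ > p - 1 > 1 and the convolution inequality is available. The shift j - 1
    -- comes from 2^j 2^k / 2.
    · have hs₂1 : 1 ≤ s₂ := by
        have : 1 < p - 1 := by
          rwa [hγdef, div_lt_one hp0] at h1
        exact le_of_lt (lt_of_le_of_lt (by simpa using this.le) hs₂)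
      obtain ⟨A, hA, h⟩ := exists_rearrangement_cubeWolffPotential_le (a := α * p) (γ := γ)
        (ν := ν) hN0 hα hγ h1 hR hK hνK
      set κ : ℕ → ℝ≥0∞ := fun j => A * 2 ^ (1 / s₁) * 2 ^ (j * (-(1 / s₁))) with hκ
      have hκT : ∑' j, κ j < ∞ := by
        rw [hκ, ENNReal.tsum_mul_left]
        exact ENNReal.mul_lt_top (ENNReal.mul_lt_top hA.lt_top (two_rpow_lt_top _))
          (tsum_rpow_natCast_mul_ne_top (by simpa using hs₁0)).lt_top
      refine lt_of_le_of_lt (sequenceNorm_mono fun k => ?_)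
        ((sequenceNorm_convolution_le hs₂1 κ (fun j : ℕ => (j : ℤ) - 1) z).trans_lt
          (ENNReal.mul_lt_top hκT hzT))
      refine (mul_le_mul_right (h (2 ^ k) (by positivity)) _).trans (le_of_eq ?_)
      rw [← ENNReal.tsum_mul_left]
      refine tsum_congr fun j => ?_
      have e : (2 : ℝ) ^ j * 2 ^ k / 2 = 2 ^ (k + ((j : ℤ) - 1)) := by
        rw [← add_sub_assoc, zpow_sub_one₀ two_ne_zero, zpow_add₀ two_ne_zero, zpow_natCast]
        ring
      simp only [hκ, hz]
      rw [e]
      have e2 : (2 : ℝ≥0∞) ^ (k / s₁) = 2 ^ (1 / s₁) * 2 ^ (j * (-(1 / s₁))) *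
          2 ^ (((k + ((j : ℤ) - 1) : ℤ) : ℝ) / s₁) := by
        rw [← ENNReal.rpow_add _ _ two_ne_zero ENNReal.ofNat_ne_top,
          ← ENNReal.rpow_add _ _ two_ne_zero ENNReal.ofNat_ne_top]
        congr 1
        push_cast
        ring
      rw [e2]
      ring
  set c : ℝ≥0∞ := 2 ^ ((N - α * p) * γ) with hc
  refine lorentzNorm_lt_top_of_sequenceNorm hs₁0 hs₂0.ne' ?_
  refine lt_of_le_of_lt (sequenceNorm_mono (w := fun k : ℤ =>
    c * (2 ^ (k / s₁) * rearrangement volume F (2 ^ k))) fun k => ?_) ?_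
  · rw [mul_left_comm]
    gcongr
    exact rearrangement_le_of_monotone (φ := fun y => c * y)
      (fun _ _ h => mul_le_mul_right h c) fun x => wolffPotential_le hp hN0 hαN hR ν x
  · rw [sequenceNorm_const_mul hs₂0.ne']
    exact ENNReal.mul_lt_top (two_rpow_lt_top _) hFT

end Main

end LorentzBessel

theorem theoremt {N : ℕ} (Ω : Set (EuclideanSpace ℝ (Fin N))) (hΩ : IsOpen Ω)
    (α p s₁ R : ℝ) (s₂ : ℝ≥0∞) (hp : 1 < p) (hα : 0 < α * p) (hαN : α * p < N)
    (hs₁ : p - 1 < s₁) (hs₂ : ENNReal.ofReal (p - 1) < s₂) (hR : 0 < R)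
    (μ : Measure (EuclideanSpace ℝ (Fin N))) (hμ : LorentzBessel.IsRadonIn Ω μ)
    (hac : LorentzBessel.AbsContCapacity (α * p) (s₁ / (s₁ - p + 1))
      (LorentzBessel.capacityExponent p s₂) Ω μ) :
    ∃ μs : ℕ → Measure (EuclideanSpace ℝ (Fin N)),
      Monotone μs ∧
      (∀ n, LorentzBessel.IsRadonIn Ω (μs n)) ∧
      (∀ n, LorentzBessel.HasCompactSupportIn Ω (μs n)) ∧
      LorentzBessel.TendstoWeakly Ω μs μ ∧
      (∀ n, LorentzBessel.MemLorentz volume s₁ s₂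
        (LorentzBessel.wolffPotential α p R (μs n))) ∧
      (μ univ < ∞ → LorentzBessel.TendstoNarrowly Ω μs μ) := by
  open LorentzBessel in
  obtain ⟨hq, hqeq⟩ := one_le_toReal_capacityExponent hp hs₂
  set q := (capacityExponent p s₂).toReal
  set s := s₁ / (s₁ - p + 1)
  have hs : 1 < s := by
    rw [lt_div_iff₀ (by linarith)]
    linarith
  obtain ⟨K, hK, hKΩ⟩ : IsSigmaCompact Ω := by
    have := hΩ.locallyCompactSpace
    exact isSigmaCompact_iff_sigmaCompactSpace.2 inferInstance
  have hKΩ' : ∀ j, K j ⊆ Ω := fun j => hKΩ ▸ subset_iUnion K j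
  -- A set is good if it lies in a compact subset of Ω and the potentials of the ball are bounded in
  -- L^1 of μ on it; both properties pass to finite unions.
  have hac' : ∀ j, ∀ E ⊆ K j, MeasurableSet E → μ E ≠ 0 → ∃ E' ⊆ E, MeasurableSet E' ∧ μ E' ≠ 0 ∧
      ((∃ L ⊆ Ω, IsCompact L ∧ E' ⊆ L) ∧ ∃ C ≠ ∞, ∀ f ∈ interpolationBall volume s q,
        ∫⁻ x in E', besselPotential (α * p) f x ∂μ ≤ C) := by
    intro j E hE hEm hE0
    have hET : μ E ≠ ∞ := ne_top_of_le_ne_top (hμ.2 _ (hKΩ' j) (hK j)).ne (measure_mono hE)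
    obtain ⟨E', hE', hE'm, hE'0, h⟩ := exists_subset_setLIntegral_besselPotential_le (a := α * p)
      hs hq hEm hET hE0 fun A hA hAm hcap =>
        hac A (hA.trans (hE.trans (hKΩ' j))) hAm (by rwa [hqeq] at hcap)
    exact ⟨E', hE', hE'm, hE'0, ⟨K j, hKΩ' j, hK j, hE'.trans hE⟩, h⟩
  obtain ⟨A, hA, hAm, hAG, hA0⟩ := exists_monotone_exhaustion
    (fun j => (hK j).measurableSet) (fun j => (hμ.2 _ (hKΩ' j) (hK j)).ne)
    ⟨⟨∅, empty_subset _, isCompact_empty, subset_rfl⟩, 0, ENNReal.zero_ne_top, by simp⟩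
    (by
      rintro A B ⟨⟨L, hLΩ, hL, hAL⟩, C, hC, hAC⟩ ⟨⟨L', hLΩ', hL', hBL⟩, D, hD, hBD⟩
      refine ⟨⟨L ∪ L', union_subset hLΩ hLΩ', hL.union hL', union_subset_union hAL hBL⟩, C + D,
        ENNReal.add_ne_top.2 ⟨hC, hD⟩, fun f hf => ?_⟩
      exact (lintegral_union_le _ _ _).trans (add_le_add (hAC f hf) (hBD f hf))) hac'
  have hfull : μ (⋃ n, A n)ᶜ = 0 := by
    rw [hKΩ] at hA0
    refine measure_mono_null (fun x hx => ?_) (measure_union_null hA0 hμ.1)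
    by_cases hxΩ : x ∈ Ω
    · exact Or.inl ⟨hxΩ, hx⟩
    · exact Or.inr hxΩ
  have hsupp : ∀ n, HasCompactSupportIn Ω (μ.restrict (A n)) := by
    intro n
    obtain ⟨⟨L, hLΩ, hL, hAL⟩, -⟩ := hAG n
    refine ⟨L, hLΩ, hL, ?_⟩
    rw [Measure.restrict_apply hL.measurableSet.compl,
      (disjoint_compl_left_iff_subset.2 hAL).inter_eq, measure_empty]
  refine ⟨fun n => μ.restrict (A n), fun m n hmn => Measure.restrict_mono (hA hmn) le_rfl,
    fun n => ⟨?_, fun L hL hLc => ?_⟩, hsupp, tendstoWeakly_restrict hμ hA hAm hfull, fun n => ?_,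
    fun hfin => tendstoNarrowly_restrict hΩ hfin hA hAm hfull⟩
  · exact Measure.absolutelyContinuous_of_le Measure.restrict_le_self hμ.1
  · exact (Measure.restrict_le_self L).trans_lt (hμ.2 L hL hLc)
  · obtain ⟨⟨L, hLΩ, hL, hAL⟩, C, hC, h⟩ := hAG n
    have hfin : IsFiniteMeasure (μ.restrict (A n)) :=
      ⟨by simpa using (measure_mono hAL).trans_lt (hμ.2 L hLΩ hL)⟩
    obtain ⟨L', -, hL', hνL⟩ := hsupp n
    exact memLorentz_wolffPotential hp hα hαN hs₁ hs₂ hR _ hL'.isBounded hνL hC h
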